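/- **Setting.** Let $n\ge 3$. A Euclidean $n$-gon $M$ is a bounded (open, connected) domain in $\mathbb R^2$ whose boundary $\partial M$ is a simple closed polygonal curve with $n$ distinct vertices: consecutive edges meet only in their common vertex and non-consecutive edges are disjoint. For $k\in\mathbb N$ let $\mathcal A_k(M)$ be the set of $k$-tuples $(\Omega_1,\dots,\Omega_k)$ of mutually disjoint non-empty open subsets of $M$ whose boundary $\partial\Omega_j\subset\mathbb R^2$ is piecewise smooth, i.e. a finite union of regular simple $C^\infty$ arcs, any two of which meet at most in common endpoints. Let $|\cdot|$ denote length (one-dimensional Hausdorff measure), put $$\eta^\partial(\Omega)=\frac{|\partial\Omega\cap M|}{|\partial\Omega\cap\partial M|}\in[0,\infty],$$ with $\eta^\partial(\Omega)=\infty$ if $\partial\Omega\cap\partial M=\emptyset$, and define the $k$-th Escobar constant of $M$ by $$I_k(M)=\inf_{(\Omega_1,\dots,\Omega_k)\in\mathcal A_k(M)}\ \max_{1\le j\le k}\eta^\partial(\Omega_j).$$ **Theorem.** Let $M$ be a Euclidean $n$-gon and let $\theta_1\in(0,2\pi)$ be the smallest of its $n$ interior angles. There exists $n_0\ge n$ (depending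 on $M$) such that $$I_k(M)=\sin(\theta_1/2)\qquad\text{for all } k\ge n_0 .$$ -/

import Mathlib

open scoped Real ENNReal ContDiff Topology MeasureTheory

noncomputable section

namespace Escobar

/-- The Euclidean plane. -/
abbrev Plane : Type := EuclideanSpace ℝ (Fin 2)

/-! ### Polygons -/

/-- The edge joining the `i`-th vertex to the next one, for a cyclically indexed list of
vertices. -/
def edge {n : ℕ} (v : ZMod n → Plane) (i : ZMod n) : Set Plane :=
  segment ℝ (v i) (v (i + 1))

/-- `v` is the cyclic list of vertices of a simple closed polygonal curve with `n ≥ 3` edges: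
the vertices are distinct, consecutive edges meet only in their common vertex, and
non-consecutive edges are disjoint. -/
structure IsSimpleClosedPolygonalCurve (n : ℕ) (v : ZMod n → Plane) : Prop where
  three_le : 3 ≤ n
  injective : Function.Injective v
  consecutive : ∀ i, edge v i ∩ edge v (i + 1) = {v (i + 1)}
  nonconsecutive : ∀ i j, j ≠ i → j ≠ i + 1 → i ≠ j + 1 → Disjoint (edge v i) (edge v j)

/-- `M` is a Euclidean `n`-gon with cyclic list of vertices `v`: a bounded planar domain whose
boundary is the simple closed polygonal curve with vertices `v`. -/
structure IsPolygon (n : ℕ) (v : ZMod n → Plane) (M : Set Plane) : Prop where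
  isSimple : IsSimpleClosedPolygonalCurve n v
  isOpen : IsOpen M
  isConnected : IsConnected M
  isBounded : Bornology.IsBounded M
  frontier_eq : frontier M = ⋃ i, edge v i

open Classical in
/-- The interior angle of the polygon `M` at its `i`-th vertex, a number in `(0, 2π)`.
The two edges at `v i` enclose the unoriented angle `∠ (v (i - 1)) (v i) (v (i + 1))`. The
interior angle is this one if `M` contains, close to `v i`, the ray from `v i` that points
between the two edges, and it is the complementary angle otherwise. (If the two edges
are collinear, both angles are `π`.) -/
def interiorAngle {n : ℕ} (M : Set Plane) (v : ZMod n → Plane) (i : ZMod n) : ℝ :=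
  if ∀ᶠ t : ℝ in 𝓝[>] 0, v i + t • ((v (i - 1) - v i) + (v (i + 1) - v i)) ∈ M then
    EuclideanGeometry.angle (v (i - 1)) (v i) (v (i + 1))
  else
    2 * π - EuclideanGeometry.angle (v (i - 1)) (v i) (v (i + 1))

/-! ### Sets with piecewise smooth boundary -/

/-- `γ`, restricted to `[0, 1]`, is a smooth regular simple arc. -/
structure IsSmoothArc (γ : ℝ → Plane) : Prop where
  contDiffOn : ContDiffOn ℝ ∞ γ (Set.Icc 0 1)
  injOn : Set.InjOn γ (Set.Icc 0 1)
  regular : ∀ t ∈ Set.Icc (0 : ℝ) 1, derivWithin γ (Set.Icc 0 1) t ≠ 0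

/-- A subset of the plane is a piecewise smooth curve system if it is the union of finitely many
smooth regular simple arcs, any two of which meet at most in common endpoints. -/
def IsPiecewiseSmooth (S : Set Plane) : Prop :=
  ∃ (m : ℕ) (γ : Fin m → ℝ → Plane),
    (∀ i, IsSmoothArc (γ i)) ∧
    (∀ i j, i ≠ j →
      γ i '' Set.Icc 0 1 ∩ γ j '' Set.Icc 0 1 ⊆ γ i '' {0, 1} ∩ γ j '' {0, 1}) ∧
    S = ⋃ i, γ i '' Set.Icc 0 1

/-- The family of non-empty open subsets of `M` with piecewise smooth boundary. -/
def admissible (M : Set Plane) : Set (Set Plane) :=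
  {Ω | Ω ⊆ M ∧ Ω.Nonempty ∧ IsOpen Ω ∧ IsPiecewiseSmooth (frontier Ω)}

/-! ### Escobar constants -/

/-- The length of a subset of the plane: its one-dimensional Hausdorff measure. -/
def length (S : Set Plane) : ℝ≥0∞ := MeasureTheory.Measure.hausdorffMeasure 1 S

/-- The interior boundary of `Ω` in the domain `M`. -/
def interiorBoundary (M Ω : Set Plane) : Set Plane := frontier Ω ∩ M

/-- The exterior boundary of `Ω` in the domain `M`. -/
def exteriorBoundary (M Ω : Set Plane) : Set Plane := frontier Ω ∩ frontier M

open Classical in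
/-- The isoperimetric ratio of `Ω` in `M`: the length of the interior boundary divided by the
length of the exterior boundary, and `∞` by convention if the exterior boundary is empty.
(If the exterior boundary is non-empty of length `0` and the interior boundary has positive
length, then the quotient in `[0, ∞]` is `∞` too.) -/
def isoperimetricRatio (M Ω : Set Plane) : ℝ≥0∞ :=
  if exteriorBoundary M Ω = ∅ then ∞
  else length (interiorBoundary M Ω) / length (exteriorBoundary M Ω)

/-- The `k`-tuples of mutually disjoint admissible subsets of `M`. -/
def admissibleTuples (M : Set Plane) (k : ℕ) : Set (Fin k → Set Plane) :=
  {Ω | (∀ j, Ω j ∈ admissible M) ∧ Pairwise fun i j => Disjoint (Ω i) (Ω j)}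

/-- The `k`-th Escobar constant of `M`. -/
def escobarConstant (M : Set Plane) (k : ℕ) : ℝ≥0∞ :=
  ⨅ Ω ∈ admissibleTuples M k, ⨆ j, isoperimetricRatio M (Ω j)

end Escobar

end

noncomputable section

namespace Escobar

open Set Filter MeasureTheory

/-! Let `θ` be the smallest interior angle and `σ = sin (θ / 2)`.

Upper bound, for every `k` (`IsPolygon.escobarConstant_le`): the vertex farthest from the origin
shows that `θ < π`, so a vertex of angle `θ` is convex. Between its edges put the isosceles
trapezoid with legs at distances from `a` to `b` from the vertex. The legs have total length `2 (b -
a)` and the bases `2 (a + b) σ`, so the ratio is at most `(b + a) / (b - a) * σ`. With `a = l * b`,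
`k` such trapezoids can be stacked towards the vertex, and `l → 0` gives `σ`.

Lower bound, for large `k` (`IsPolygon.exists_le_escobarConstant`): the exterior boundaries of
disjoint admissible sets overlap only in finitely many points, so their lengths add up to at most
`|∂M|` and some `Ω` has a short one. If its interior boundary is at least as long as the exterior
one, the ratio is at least `1 ≥ σ`. Otherwise the whole perimeter of `Ω` is small, and
`IsPolygon.exists_isoperimetric` applies.

That inequality is proved by slicing. Each edge is cut into two halves, one for each end, by a
perpendicular line that misses `∂Ω`; a short `∂Ω` cannot block all lines over the middle third. From
almost every exterior boundary point on a half-edge a segment enters `Ω`, in the direction of the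
bisector if the nearby vertex is convex and of the inward normal otherwise. It leaves `Ω` at a point
of `∂Ω ∩ M` (`IsPolygon.exists_mem_sweep`). Projection along the slices is 1-Lipschitz and scales
length on the edge by the sine of the angle between edge and slice, which is at least `σ`
(`IsPolygon.sin_le_abs_cross_flow`). The regions swept from different half-edges are disjoint
(`IsPolygon.disjoint_sweep`), so the estimates add up.

Two facts support the slicing: the polygon lies on one side of each edge
(`IsPolygon.notMem_interior_closure`, by connectedness of the boundary), and away from finitely many
points `Ω` fills a one-sided neighbourhood of its smooth boundary (`exists_finite_eventually_mem`).
-/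

/-! ### Dot and cross product in the plane -/

/-- The dot product in coordinates. -/
def dot (a b : Plane) : ℝ := a 0 * b 0 + a 1 * b 1

/-- The oriented area of the parallelogram spanned by two plane vectors. -/
def cross (a b : Plane) : ℝ := a 0 * b 1 - a 1 * b 0

/-- The rotation by a right angle. -/
def perp (a : Plane) : Plane := !₂[-a 1, a 0]

@[simp] lemma perp_zero_apply (a : Plane) : perp a 0 = -a 1 := rfl
@[simp] lemma perp_one_apply (a : Plane) : perp a 1 = a 0 := rfl

lemma plane_ext {a b : Plane} (h0 : a 0 = b 0) (h1 : a 1 = b 1) : a = b := by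
  ext i; fin_cases i <;> assumption

lemma inner_eq_dot (a b : Plane) : inner ℝ a b = dot a b := by
  simp [PiLp.inner_apply, Fin.sum_univ_two, dot]; ring

lemma norm_sq_eq_dot (a : Plane) : ‖a‖ ^ 2 = dot a a := by
  rw [← inner_eq_dot, real_inner_self_eq_norm_sq]

lemma abs_dot_le (a b : Plane) : |dot a b| ≤ ‖a‖ * ‖b‖ := by
  rw [← inner_eq_dot]; exact abs_real_inner_le_norm a b

lemma dot_perp (a b : Plane) : dot a (perp b) = -cross a b := by
  simp [dot, cross]; ring

lemma norm_perp (a : Plane) : ‖perp a‖ = ‖a‖ := by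
  have : ‖perp a‖ ^ 2 = ‖a‖ ^ 2 := by
    rw [norm_sq_eq_dot, norm_sq_eq_dot]; simp [dot]; ring
  exact (sq_eq_sq₀ (norm_nonneg _) (norm_nonneg _)).1 this

lemma abs_cross_le (a b : Plane) : |cross a b| ≤ ‖a‖ * ‖b‖ := by
  have := abs_dot_le a (perp b)
  rwa [dot_perp, abs_neg, norm_perp] at this

lemma dot_comm (a b : Plane) : dot a b = dot b a := by simp [dot]; ring
lemma dot_add_left (a b c : Plane) : dot (a + b) c = dot a c + dot b c := by simp [dot]; ring
lemma dot_sub_left (a b c : Plane) : dot (a - b) c = dot a c - dot b c := by simp [dot]; ring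
lemma dot_smul_left (t : ℝ) (a c : Plane) : dot (t • a) c = t * dot a c := by simp [dot]; ring
lemma dot_add_right (a b c : Plane) : dot c (a + b) = dot c a + dot c b := by simp [dot]; ring
lemma dot_smul_right (t : ℝ) (a c : Plane) : dot c (t • a) = t * dot c a := by simp [dot]; ring
lemma cross_add_left (a b c : Plane) : cross (a + b) c = cross a c + cross b c := by
  simp [cross]; ring
lemma cross_sub_left (a b c : Plane) : cross (a - b) c = cross a c - cross b c := by
  simp [cross]; ring
lemma cross_smul_left (t : ℝ) (a c : Plane) : cross (t • a) c = t * cross a c := by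
  simp [cross]; ring
lemma cross_add_right (a b c : Plane) : cross c (a + b) = cross c a + cross c b := by
  simp [cross]; ring
lemma cross_smul_right (t : ℝ) (a c : Plane) : cross c (t • a) = t * cross c a := by
  simp [cross]; ring
@[simp] lemma cross_self (a : Plane) : cross a a = 0 := by simp [cross]; ring
lemma cross_swap (a b : Plane) : cross a b = -cross b a := by simp [cross]; ring

lemma dot_self_eq_one {a : Plane} (ha : ‖a‖ = 1) : dot a a = 1 := by
  rw [← norm_sq_eq_dot, ha, one_pow]

lemma norm_eq_one_of_dot {a : Plane} (ha : dot a a = 1) : ‖a‖ = 1 := by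
  have h := norm_sq_eq_dot a
  rw [ha] at h
  nlinarith [norm_nonneg a]

lemma continuous_dot_left (b : Plane) : Continuous fun a => dot a b := by
  unfold dot; fun_prop

lemma continuous_cross_left (b : Plane) : Continuous fun a => cross a b := by
  unfold cross; fun_prop

lemma continuous_cross_right (b : Plane) : Continuous fun a => cross b a := by
  unfold cross; fun_prop

/-- Decomposition of a vector along a unit vector and its rotation. -/
lemma eq_dot_smul_add_cross_smul {u : Plane} (hu : ‖u‖ = 1) (a : Plane) :
    a = dot a u • u + cross u a • perp u := by
  have h := dot_self_eq_one hu
  simp only [dot] at h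
  apply plane_ext
  · simp [dot, cross]; linear_combination (-(a 0)) * h
  · simp [dot, cross]; linear_combination (-(a 1)) * h

lemma eq_smul_of_cross_eq_zero {u : Plane} (hu : ‖u‖ = 1) {a : Plane} (h : cross a u = 0) :
    a = dot a u • u := by
  conv_lhs => rw [eq_dot_smul_add_cross_smul hu a, cross_swap, h]
  simp

/-- Cramer's rule. -/
lemma cross_smul_eq (a b c : Plane) : cross a b • c = cross c b • a + cross a c • b := by
  apply plane_ext <;> simp [cross] <;> ring

lemma sq_cross_add_sq_dot (a b : Plane) : cross a b ^ 2 + dot a b ^ 2 = dot a a * dot b b := by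
  simp [cross, dot]; ring

lemma lipschitzWith_dot {u : Plane} (hu : ‖u‖ = 1) (p : Plane) :
    LipschitzWith 1 fun q => dot (q - p) u := by
  refine LipschitzWith.of_dist_le_mul fun x y => ?_
  have := abs_dot_le (x - y) u
  rw [Real.dist_eq, dist_eq_norm, NNReal.coe_one, one_mul]
  rw [hu, mul_one] at this
  convert this using 2
  rw [← dot_sub_left]; congr 1; abel

lemma lipschitzWith_cross {u : Plane} (hu : ‖u‖ = 1) (p : Plane) :
    LipschitzWith 1 fun q => cross (q - p) u := by
  refine LipschitzWith.of_dist_le_mul fun x y => ?_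
  have := abs_cross_le (x - y) u
  rw [Real.dist_eq, dist_eq_norm, NNReal.coe_one, one_mul]
  rw [hu, mul_one] at this
  convert this using 2
  rw [← cross_sub_left]; congr 1; abel

/-! ### Length -/

lemma length_mono {S T : Set Plane} (h : S ⊆ T) : length S ≤ length T := measure_mono h

/-- 1-Lipschitz maps do not increase one-dimensional Hausdorff measure. Applied to projections, this
bounds from below the length of a frontier of unknown shape. -/
lemma volume_le_length {f : Plane → ℝ} (hf : LipschitzWith 1 f) {A : Set ℝ} {S : Set Plane}
    (h : ∀ x ∈ A, ∃ q ∈ S, f q = x) : volume A ≤ length S := by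
  have h1 := hf.hausdorffMeasure_image_le (d := 1) zero_le_one S
  rw [hausdorffMeasure_real] at h1
  simp only [ENNReal.coe_one, ENNReal.one_rpow, one_mul] at h1
  exact (measure_mono fun x hx => h x hx).trans h1

lemma length_image_line_le {e : Plane} (he : ‖e‖ = 1) (p : Plane) (A : Set ℝ) :
    length ((fun x : ℝ => p + x • e) '' A) ≤ volume A := by
  have hf : LipschitzWith 1 (fun x : ℝ => p + x • e) := by
    refine LipschitzWith.of_dist_le_mul fun x y => ?_
    rw [dist_add_left, dist_eq_norm, ← sub_smul, norm_smul, he, NNReal.coe_one, one_mul, mul_one,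
      dist_eq_norm]
  have h1 := hf.hausdorffMeasure_image_le (d := 1) zero_le_one A
  rw [hausdorffMeasure_real] at h1
  simp only [ENNReal.coe_one, ENNReal.one_rpow, one_mul] at h1
  exact h1

lemma length_segment (x y : Plane) : length (segment ℝ x y) = edist x y :=
  hausdorffMeasure_segment x y

lemma length_finite {F : Set Plane} (hF : F.Finite) : length F = 0 := by
  have := Measure.nullSingletonClass_hausdorff (X := Plane) one_pos
  exact hF.measure_zero _

/-! ### Frontiers -/

/-- Off the frontier, `U` and the complement of its closure form an open partition, and a connected
set cannot meet both parts. -/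
lemma subset_of_isPreconnected {X : Type*} [TopologicalSpace X] {S U : Set X}
    (hS : IsPreconnected S) (hU : IsOpen U) (hd : Disjoint S (frontier U))
    (hne : (S ∩ U).Nonempty) : S ⊆ U := by
  by_contra hnot
  obtain ⟨y, hyS, hyU⟩ := not_subset.1 hnot
  have key : ∀ z ∈ S, z ∉ U → z ∈ (closure U)ᶜ := fun z hz hzU hzc =>
    hd.le_bot ⟨hz, by rw [hU.frontier_eq]; exact ⟨hzc, hzU⟩⟩
  obtain ⟨z, -, hz1, hz2⟩ := hS U (closure U)ᶜ hU isClosed_closure.isOpen_compl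
    (fun z hz => by
      by_cases h : z ∈ U
      · exact Or.inl h
      · exact Or.inr (key z hz h)) hne ⟨y, hyS, key y hyS hyU⟩
  exact hz2 (subset_closure hz1)

/-- First exit from a bounded open set along a ray. -/
lemma exists_exit {U : Set Plane} (hU : IsOpen U) (hb : Bornology.IsBounded U) {p u : Plane}
    (hu : u ≠ 0) (h : ∀ᶠ t : ℝ in 𝓝[>] 0, p + t • u ∈ U) :
    ∃ T > (0 : ℝ), (∀ t ∈ Ioo 0 T, p + t • u ∈ U) ∧ p + T • u ∈ frontier U := by
  obtain ⟨ε, hε, hεU⟩ := mem_nhdsGT_iff_exists_Ioo_subset.1 h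
  simp only [mem_Ioi] at hε
  have hc : Continuous fun t : ℝ => p + t • u := by fun_prop
  -- The point `p` itself may lie outside `U`; the cut-off at `ε` keeps the infimum of exit times
  -- positive.
  set S : Set ℝ := {t | ε ≤ t ∧ p + t • u ∉ U} with hS
  have hSc : IsClosed S := isClosed_Ici.inter (hU.isClosed_compl.preimage hc)
  have hSb : BddBelow S := ⟨ε, fun t ht => ht.1⟩
  have hSn : S.Nonempty := by
    obtain ⟨R, hR⟩ := hb.subset_closedBall 0
    have hu' : 0 < ‖u‖ := norm_pos_iff.2 hu
    refine ⟨max ε ((|R| + ‖p‖ + 1) / ‖u‖), le_max_left _ _, fun hmem => ?_⟩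
    have h1 := hR hmem
    rw [mem_closedBall_zero_iff] at h1
    set t := max ε ((|R| + ‖p‖ + 1) / ‖u‖)
    have ht : |R| + ‖p‖ + 1 ≤ t * ‖u‖ := (div_le_iff₀ hu').1 (le_max_right _ _)
    have ht0 : 0 ≤ t := hε.le.trans (le_max_left _ _)
    have h2 : ‖t • u‖ ≤ ‖p + t • u‖ + ‖p‖ := by
      calc ‖t • u‖ = ‖(p + t • u) - p‖ := by congr 1; abel
        _ ≤ _ := norm_sub_le _ _
    rw [norm_smul, Real.norm_of_nonneg ht0] at h2
    linarith [le_abs_self R]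
  have hmem := hSc.csInf_mem hSn hSb
  have hin : ∀ t ∈ Ioo (0 : ℝ) (sInf S), p + t • u ∈ U := by
    intro t ht
    rcases lt_or_ge t ε with h1 | h1
    · exact hεU ⟨ht.1, h1⟩
    · by_contra h2
      exact absurd (csInf_le hSb ⟨h1, h2⟩) (not_le.2 ht.2)
  have hpos : 0 < sInf S := hε.trans_le hmem.1
  refine ⟨_, hpos, hin, ?_⟩
  rw [hU.frontier_eq]
  refine ⟨?_, hmem.2⟩
  have : sInf S ∈ closure (Ioo (0 : ℝ) (sInf S)) := by
    rw [closure_Ioo hpos.ne]; exact ⟨hpos.le, le_rfl⟩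
  exact closure_mono (image_subset_iff.2 hin) (image_closure_subset_closure_image hc ⟨_, this, rfl⟩)

lemma exists_frontier_of_mem {U : Set Plane} (hU : IsOpen U) (hb : Bornology.IsBounded U)
    {p u : Plane} (hu : u ≠ 0) (hp : p ∈ U) : ∃ t > (0 : ℝ), p + t • u ∈ frontier U := by
  have hc : ContinuousAt (fun t : ℝ => p + t • u) 0 := by fun_prop
  have h : ∀ᶠ t : ℝ in 𝓝[>] 0, p + t • u ∈ U :=
    nhdsWithin_le_nhds (hc.eventually_mem (hU.mem_nhds (by simpa using hp)))
  obtain ⟨T, hT, -, h2⟩ := exists_exit hU hb hu h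
  exact ⟨T, hT, h2⟩

/-- A segment contained in a bounded open set is no longer than the frontier of the set. -/
lemma ofReal_le_length_frontier {U : Set Plane} (hU : IsOpen U) (hb : Bornology.IsBounded U)
    {p u : Plane} (hu : ‖u‖ = 1) {T : ℝ} (h : ∀ t ∈ Ioo 0 T, p + t • u ∈ U) :
    ENNReal.ofReal T ≤ length (frontier U) := by
  have := volume_le_length (lipschitzWith_dot hu p) (A := Ioo 0 T) (S := frontier U) (by
    intro t ht
    have hne : perp u ≠ 0 := by
      rw [← norm_pos_iff, norm_perp, hu]; exact one_pos
    -- The perpendicular ray from each point of the segment must leave `U`, and the frontier point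
    -- found there projects back to the starting point.
    obtain ⟨s, -, hs⟩ := exists_frontier_of_mem hU hb hne (h t ht)
    refine ⟨_, hs, ?_⟩
    have h1 := dot_self_eq_one hu
    simp only [dot, PiLp.add_apply, PiLp.sub_apply, PiLp.smul_apply, smul_eq_mul, perp_zero_apply,
      perp_one_apply] at h1 ⊢
    linear_combination t * h1)
  simpa using this

/-- A line that avoids the frontier of a bounded open set avoids the set. -/
lemma not_mem_of_line {U : Set Plane} (hU : IsOpen U) (hb : Bornology.IsBounded U)
    {p e : Plane} (he : ‖e‖ = 1) {m : ℝ} (h : ∀ q ∈ frontier U, dot (q - p) e ≠ m) :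
    ∀ q ∈ U, dot (q - p) e ≠ m := by
  intro q hq hqm
  have hne : perp e ≠ 0 := by
    rw [← norm_pos_iff, norm_perp, he]; exact one_pos
  obtain ⟨s, -, hs⟩ := exists_frontier_of_mem hU hb hne hq
  refine h _ hs ?_
  rw [← hqm]
  simp only [dot, PiLp.add_apply, PiLp.sub_apply, PiLp.smul_apply, perp_zero_apply,
      perp_one_apply]
  ring

/-! ### Open sets with piecewise smooth frontier -/

/-- `F` collects the endpoints of the arcs. Any other point lies on a single arc and, by
compactness, at positive distance from the other arcs and from the part of its own arc with
parameters away from `t₀`. -/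
lemma exists_finite_arcs {S : Set Plane} (hS : IsPiecewiseSmooth S) :
    ∃ F : Set Plane, F.Finite ∧ ∀ p ∈ S, p ∉ F → ∃ γ : ℝ → Plane, IsSmoothArc γ ∧
      ∃ t₀ ∈ Ioo (0 : ℝ) 1, γ t₀ = p ∧ γ '' Icc 0 1 ⊆ S ∧
        ∀ V ∈ 𝓝 t₀, ∀ᶠ q in 𝓝 p, q ∈ S → ∃ t ∈ V, γ t = q := by
  obtain ⟨m, γ, hγ, hij, rfl⟩ := hS
  refine ⟨⋃ i, γ i '' {0, 1}, finite_iUnion fun i => (toFinite _).image _, ?_⟩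
  intro p hp hpF
  obtain ⟨i, t₀, ht₀, rfl⟩ := mem_iUnion.1 hp
  have hend : ∀ j, γ i t₀ ∉ γ j '' {0, 1} := fun j hj => hpF (mem_iUnion.2 ⟨j, hj⟩)
  have h0 : t₀ ≠ 0 := by rintro rfl; exact hend i ⟨0, by simp, rfl⟩
  have h1 : t₀ ≠ 1 := by rintro rfl; exact hend i ⟨1, by simp, rfl⟩
  refine ⟨γ i, hγ i, t₀, ⟨lt_of_le_of_ne ht₀.1 h0.symm, lt_of_le_of_ne ht₀.2 h1⟩, rfl,
    subset_iUnion (fun i => γ i '' Icc 0 1) i, ?_⟩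
  intro V hV
  have hK : IsCompact (Icc (0 : ℝ) 1 \ interior V) := isCompact_Icc.diff isOpen_interior
  have hK1 : IsClosed (γ i '' (Icc (0 : ℝ) 1 \ interior V)) :=
    (hK.image_of_continuousOn ((hγ i).contDiffOn.continuousOn.mono sdiff_subset)).isClosed
  have hK2 : IsClosed (⋃ j ∈ {j | j ≠ i}, γ j '' Icc (0 : ℝ) 1) :=
    (toFinite _).isClosed_biUnion fun j _ =>
      (isCompact_Icc.image_of_continuousOn (hγ j).contDiffOn.continuousOn).isClosed
  have hn1 : γ i t₀ ∉ γ i '' (Icc (0 : ℝ) 1 \ interior V) := by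
    rintro ⟨t, ht, hte⟩
    have := (hγ i).injOn ht.1 ht₀ hte
    exact ht.2 (this ▸ mem_interior_iff_mem_nhds.2 hV)
  have hn2 : γ i t₀ ∉ ⋃ j ∈ {j | j ≠ i}, γ j '' Icc (0 : ℝ) 1 := by
    intro h
    obtain ⟨j, hj, hjm⟩ := mem_iUnion₂.1 h
    have hmem := hij j i hj (mem_inter hjm (mem_image_of_mem _ ht₀))
    exact hend j hmem.1
  filter_upwards [hK1.isOpen_compl.mem_nhds hn1, hK2.isOpen_compl.mem_nhds hn2] with q hq1 hq2 hq
  obtain ⟨j, t, ht, rfl⟩ := mem_iUnion.1 hq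
  by_cases hji : j = i
  · subst hji
    refine ⟨t, ?_, rfl⟩
    by_contra htV
    exact hq1 ⟨t, ⟨ht, fun h => htV (interior_subset h)⟩, rfl⟩
  · exact absurd (mem_biUnion (show j ∈ {j | j ≠ i} from hji) (mem_image_of_mem (γ j) ht)) hq2

/-- At a regular frontier point at which an open set lies on one side of a line, every vector
pointing strictly to that side points into the set. -/
lemma exists_finite_eventually_mem {U : Set Plane} (hU : IsOpen U)
    (hS : IsPiecewiseSmooth (frontier U)) :
    ∃ F : Set Plane, F.Finite ∧ ∀ p ∈ frontier U, p ∉ F → ∀ ν u : Plane, ‖u‖ = 1 →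
      0 < dot u ν → (∀ᶠ q in 𝓝 p, q ∈ U → 0 ≤ dot (q - p) ν) →
      ∀ᶠ t : ℝ in 𝓝[>] 0, p + t • u ∈ U := by
  obtain ⟨F, hF, h⟩ := exists_finite_arcs hS
  refine ⟨F, hF, fun p hp hpF ν u hu huν hside => ?_⟩
  obtain ⟨γ, hγ, t₀, ht₀, rfl, hsub, hloc⟩ := h p hp hpF
  have hIcc : Icc (0 : ℝ) 1 ∈ 𝓝 t₀ := Icc_mem_nhds ht₀.1 ht₀.2
  have hcd : ContDiffAt ℝ ∞ γ t₀ := hγ.contDiffOn.contDiffAt hIcc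
  have hstr := hcd.hasStrictDerivAt (by simp)
  set D := deriv γ t₀ with hD
  have hD0 : D ≠ 0 := by
    rw [hD, ← derivWithin_of_mem_nhds hIcc]; exact hγ.regular t₀ (Ioo_subset_Icc_self ht₀)
  have hcoord : ∀ i, HasStrictDerivAt (fun t => γ t i) (D i) t₀ := by
    intro i
    exact (EuclideanSpace.proj i : Plane →L[ℝ] ℝ).hasStrictFDerivAt.comp_hasStrictDerivAt t₀ hstr
  have hcont : ContinuousAt γ t₀ := hcd.continuousAt
  -- the frontier lies on the same side
  have hside' : ∀ᶠ q in 𝓝 (γ t₀), q ∈ closure U → 0 ≤ dot (q - γ t₀) ν := by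
    obtain ⟨O, hO, hOo, hpO⟩ := eventually_nhds_iff.1 hside
    refine eventually_nhds_iff.2 ⟨O, fun q hq hqU => ?_, hOo, hpO⟩
    have : q ∈ closure (O ∩ U) := by
      rw [mem_closure_iff] at hqU ⊢
      intro o ho hqo
      obtain ⟨z, hz, hzU⟩ := hqU (o ∩ O) (ho.inter hOo) ⟨hqo, hq⟩
      exact ⟨z, hz.1, hz.2, hzU⟩
    have hcl : IsClosed {q : Plane | 0 ≤ dot (q - γ t₀) ν} :=
      isClosed_le continuous_const ((continuous_dot_left ν).comp (by fun_prop))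
    exact hcl.closure_subset_iff.2 (fun z hz => hO z hz.1 hz.2) this
  have hDν : dot D ν = 0 := by
    have hmin : IsLocalMin (fun t => dot (γ t - γ t₀) ν) t₀ := by
      filter_upwards [hcont.eventually hside', hIcc] with t ht ht1
      have := ht (frontier_subset_closure (hsub ⟨t, ht1, rfl⟩))
      simpa [dot] using this
    have hder : HasDerivAt (fun t => dot (γ t - γ t₀) ν) (dot D ν) t₀ := by
      have h0 : HasDerivAt (fun t => γ t 0 - γ t₀ 0) (D 0) t₀ := (hcoord 0).hasDerivAt.sub_const _
      have h1 : HasDerivAt (fun t => γ t 1 - γ t₀ 1) (D 1) t₀ := (hcoord 1).hasDerivAt.sub_const _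
      exact (h0.mul_const (ν 0)).add (h1.mul_const (ν 1))
    exact hmin.hasDerivAt_eq_zero hder
  -- The tangent is orthogonal to `ν` and `u` is not, so `u` is transversal to the arc. Thus `(t, s)
  -- ↦ γ t + s • u` acts as a chart near the point in which the frontier is `s = 0`.
  have hDu : cross D u ≠ 0 := by
    intro h0
    rw [eq_smul_of_cross_eq_zero hu h0, dot_smul_left] at hDν
    rcases mul_eq_zero.1 hDν with h1 | h1
    · apply hD0; rw [eq_smul_of_cross_eq_zero hu h0, h1, zero_smul]
    · exact huν.ne' h1
  set φ : ℝ → ℝ := fun t => cross (γ t - γ t₀) u with hφ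
  have hφd : HasStrictDerivAt φ (cross D u) t₀ := by
    have h0 : HasStrictDerivAt (fun t => γ t 0 - γ t₀ 0) (D 0) t₀ := (hcoord 0).sub_const _
    have h1 : HasStrictDerivAt (fun t => γ t 1 - γ t₀ 1) (D 1) t₀ := (hcoord 1).sub_const _
    exact (h0.mul_const (u 1)).sub (h1.mul_const (u 0))
  have hinj : ∃ V ∈ 𝓝 t₀, InjOn φ V := by
    have hf := hφd.hasStrictFDerivAt_equiv hDu
    refine ⟨(hf.toOpenPartialHomeomorph φ).source,
      (hf.toOpenPartialHomeomorph φ).open_source.mem_nhds hf.mem_toOpenPartialHomeomorph_source, ?_⟩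
    exact (hf.toOpenPartialHomeomorph φ).injOn
  obtain ⟨V, hV, hVinj⟩ := hinj
  have hG : ContinuousAt (fun x : ℝ × ℝ => γ x.1 + x.2 • u) (t₀, 0) := by
    refine ContinuousAt.add ?_ (by fun_prop)
    exact ContinuousAt.comp (f := Prod.fst) (g := γ) hcont continuousAt_fst
  have hGt : Tendsto (fun x : ℝ × ℝ => γ x.1 + x.2 • u) (𝓝 t₀ ×ˢ 𝓝 0) (𝓝 (γ t₀)) := by
    have := hG.tendsto
    rwa [zero_smul, add_zero, nhds_prod_eq] at this
  have hev := (hGt.eventually (hloc V hV)).and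
    ((hGt.eventually hside).and ((tendsto_fst (f := 𝓝 t₀) (g := 𝓝 (0 : ℝ))).eventually
      (inter_mem hV hIcc)))
  rw [← nhds_prod_eq] at hev
  obtain ⟨η, hη, hηe⟩ := Metric.eventually_nhds_iff.1 hev
  have hcball : ∃ δ > 0, ∀ t, |t - t₀| < δ → ‖γ t - γ t₀‖ < η / 2 := by
    obtain ⟨δ, hδ, h⟩ := Metric.continuousAt_iff.1 hcont (η / 2) (half_pos hη)
    exact ⟨δ, hδ, fun t ht => by simpa [dist_eq_norm] using h (by simpa [Real.dist_eq] using ht)⟩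
  obtain ⟨δ', hδ', hδγ⟩ := hcball
  set δ := min δ' η with hδdef
  have hδ : 0 < δ := lt_min hδ' hη
  have hP : ∀ t s : ℝ, |t - t₀| < δ → |s| < η → (γ t + s • u ∈ frontier U → ∃ t' ∈ V, γ t' = γ t + s • u)
      ∧ (γ t + s • u ∈ U → 0 ≤ dot (γ t + s • u - γ t₀) ν) ∧ t ∈ V ∧ t ∈ Icc (0:ℝ) 1 := by
    intro t s ht hs
    have := @hηe (t, s) (by
      rw [Prod.dist_eq, max_lt_iff]
      exact ⟨by simpa [Real.dist_eq] using ht.trans_le (min_le_right _ _),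
        by simpa [Real.dist_eq] using hs⟩)
    exact this
  -- `φ` is blind to displacements along `u` and injective along the arc, so a translate of an arc
  -- point along `u` is on the arc only if it is not translated at all.
  have hoff : ∀ t s : ℝ, |t - t₀| < δ → |s| < η → γ t + s • u ∈ frontier U → s = 0 := by
    intro t s ht hs hmem
    obtain ⟨t', ht', he⟩ := (hP t s ht hs).1 hmem
    have h1 : φ t' = φ t := by
      simp only [hφ]
      rw [he, add_sub_right_comm, cross_add_left, cross_smul_left, cross_self, mul_zero, add_zero]
    rw [hVinj ht' (hP t s ht hs).2.2.1 h1] at he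
    have h2 : s • u = 0 := by simpa using he.symm
    rcases smul_eq_zero.1 h2 with h3 | h3
    · exact h3
    · rw [h3, norm_zero] at hu; exact absurd hu zero_ne_one
  -- The half of the box on either side of the arc is connected and misses the frontier, so it lies
  -- in `U` as soon as it meets `U`.
  have hpre : ∀ I : Set ℝ, Convex ℝ I → (∀ s ∈ I, |s| < η ∧ s ≠ 0) →
      (∃ t s, |t - t₀| < δ ∧ s ∈ I ∧ γ t + s • u ∈ U) →
      ∀ t s, |t - t₀| < δ → s ∈ I → γ t + s • u ∈ U := by
    intro I hI hIη hex t s ht hs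
    have hball : ∀ t, t ∈ Metric.ball t₀ δ ↔ |t - t₀| < δ := fun t => by
      rw [Metric.mem_ball, Real.dist_eq]
    have hS : IsPreconnected ((fun x : ℝ × ℝ => γ x.1 + x.2 • u) '' (Metric.ball t₀ δ ×ˢ I)) := by
      refine ((convex_ball t₀ δ).prod hI).isPreconnected.image _ ?_
      refine ContinuousOn.add ?_ (by fun_prop)
      refine (hγ.contDiffOn.continuousOn).comp continuousOn_fst ?_
      rintro ⟨t, s⟩ ⟨h1, h2⟩
      exact (hP t s ((hball t).1 h1) (hIη s h2).1).2.2.2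
    refine subset_of_isPreconnected hS hU ?_ ?_ ⟨(t, s), ⟨(hball t).2 ht, hs⟩, rfl⟩
    · rw [Set.disjoint_left]
      rintro _ ⟨⟨t, s⟩, ⟨h1, h2⟩, rfl⟩ hf
      exact (hIη s h2).2 (hoff t s ((hball t).1 h1) (hIη s h2).1 hf)
    · obtain ⟨t, s, h1, h2, h3⟩ := hex
      exact ⟨_, ⟨(t, s), ⟨(hball t).2 h1, h2⟩, rfl⟩, h3⟩
  -- points of `U` near the frontier point lie above the arc
  have hexU : ∃ t s, |t - t₀| < δ ∧ s ∈ Ioo 0 η ∧ γ t + s • u ∈ U := by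
    by_contra hno
    have hcov : ∀ᶠ q in 𝓝 (γ t₀), ∃ t, |t - t₀| < δ ∧ cross (q - γ t₀) u = φ t := by
      have hm := hφd.map_nhds_eq hDu
      have h1 : φ '' (Metric.ball t₀ δ) ∈ 𝓝 (φ t₀) := by
        rw [← hm]; exact image_mem_map (Metric.ball_mem_nhds _ hδ)
      have hc : ContinuousAt (fun q => cross (q - γ t₀) u) (γ t₀) :=
        ((continuous_cross_left u).comp (by fun_prop)).continuousAt
      filter_upwards [hc.eventually_mem h1] with q ⟨t, ht, he⟩
      exact ⟨t, by simpa [Real.dist_eq] using ht, he.symm⟩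
    have hU0 : ∀ᶠ q in 𝓝 (γ t₀), q ∉ U := by
      filter_upwards [hcov, Metric.ball_mem_nhds (γ t₀) (half_pos hη)] with q ⟨t, ht, he⟩ hqb hqU
      set s := dot (q - γ t) u with hs
      have hq : q = γ t + s • u := by
        rw [hs, ← eq_smul_of_cross_eq_zero hu]
        · abel
        · have : q - γ t = (q - γ t₀) - (γ t - γ t₀) := by abel
          rw [this, cross_sub_left, he]; simp [hφ]
      have hsη : |s| < η := by
        have h1 := abs_dot_le (q - γ t) u
        rw [hu, mul_one] at h1
        have h2 : ‖q - γ t‖ ≤ ‖q - γ t₀‖ + ‖γ t - γ t₀‖ := by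
          have : q - γ t = (q - γ t₀) - (γ t - γ t₀) := by abel
          rw [this]; exact norm_sub_le _ _
        have h3 : ‖q - γ t₀‖ < η / 2 := by simpa [dist_eq_norm] using hqb
        have h4 := hδγ t (ht.trans_le (min_le_left _ _))
        linarith
      rw [hq] at hqU
      -- A point of `U` below the arc would put the lower half of the box into `U`, against the side
      -- condition on the line `t = t₀`. A point on the arc is a frontier point, and points above
      -- are excluded by assumption.
      rcases lt_trichotomy s 0 with h0 | h0 | h0
      · have := hpre (Ioo (-η) 0) (convex_Ioo _ _)
          (fun s hs => ⟨by rw [abs_lt]; exact ⟨hs.1, by linarith [hs.2]⟩, hs.2.ne⟩)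
          ⟨t, s, ht, ⟨by linarith [(abs_lt.1 hsη).1], h0⟩, hqU⟩ t₀ (-(η / 2)) (by simpa using hδ)
          ⟨by linarith, by linarith⟩
        have h5 := (hP t₀ (-(η / 2)) (by simpa using hδ)
          (by rw [abs_neg, abs_of_pos (half_pos hη)]; linarith)).2.1 this
        rw [add_sub_cancel_left, dot_smul_left] at h5
        nlinarith
      · have h6 : γ t ∈ frontier U := hsub ⟨t, (hP t 0 ht (by simpa using hη)).2.2.2, rfl⟩
        rw [h0, zero_smul, add_zero] at hqU
        rw [hU.frontier_eq] at h6
        exact h6.2 hqU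
      · exact hno ⟨t, s, ht, ⟨h0, (abs_lt.1 hsη).2⟩, hqU⟩
    have hcl := mem_closure_iff_frequently.1 (frontier_subset_closure hp)
    exact hcl hU0
  have hup := hpre (Ioo 0 η) (convex_Ioo _ _)
    (fun s hs => ⟨by rw [abs_lt]; exact ⟨by linarith [hs.1], hs.2⟩, hs.1.ne'⟩) hexU
  filter_upwards [Ioo_mem_nhdsGT hη] with s hs
  exact hup t₀ s (by simpa using hδ) hs

/-! ### Flags of a polygon -/

/-- The vertex at which a flag (an oriented edge) starts. -/
def tail {n : ℕ} (v : ZMod n → Plane) (f : ZMod n × Bool) : Plane := cond f.2 (v f.1) (v (f.1 + 1))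

/-- The vertex at which a flag ends. -/
def head {n : ℕ} (v : ZMod n → Plane) (f : ZMod n × Bool) : Plane := cond f.2 (v (f.1 + 1)) (v f.1)

/-- The length of the edge of a flag. -/
def len {n : ℕ} (v : ZMod n → Plane) (f : ZMod n × Bool) : ℝ := ‖head v f - tail v f‖

/-- The unit direction of a flag. -/
def dir {n : ℕ} (v : ZMod n → Plane) (f : ZMod n × Bool) : Plane :=
  (len v f)⁻¹ • (head v f - tail v f)

/-- The other flag that starts at the same vertex. -/
def mate {n : ℕ} (f : ZMod n × Bool) : ZMod n × Bool := cond f.2 (f.1 - 1, false) (f.1 + 1, true)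

/-- The flag with the same edge and the opposite orientation. -/
def opp {n : ℕ} (f : ZMod n × Bool) : ZMod n × Bool := (f.1, !f.2)

@[simp] lemma tail_mate {n : ℕ} (v : ZMod n → Plane) (f : ZMod n × Bool) :
    tail v (mate f) = tail v f := by
  obtain ⟨i, _ | _⟩ := f <;> simp [tail, mate]

@[simp] lemma mate_mate {n : ℕ} (f : ZMod n × Bool) : mate (mate f) = f := by
  obtain ⟨i, _ | _⟩ := f <;> simp [mate]

@[simp] lemma tail_opp {n : ℕ} (v : ZMod n → Plane) (f : ZMod n × Bool) :
    tail v (opp f) = head v f := by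
  obtain ⟨i, _ | _⟩ := f <;> simp [tail, head, opp]

@[simp] lemma head_opp {n : ℕ} (v : ZMod n → Plane) (f : ZMod n × Bool) :
    head v (opp f) = tail v f := by
  obtain ⟨i, _ | _⟩ := f <;> simp [tail, head, opp]

@[simp] lemma len_opp {n : ℕ} (v : ZMod n → Plane) (f : ZMod n × Bool) :
    len v (opp f) = len v f := by
  simp [len, norm_sub_rev]

@[simp] lemma dir_opp {n : ℕ} (v : ZMod n → Plane) (f : ZMod n × Bool) :
    dir v (opp f) = -dir v f := by
  simp [dir, ← smul_neg]
section Simple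

variable {n : ℕ} {v : ZMod n → Plane}

lemma IsSimpleClosedPolygonalCurve.one_ne_zero (hv : IsSimpleClosedPolygonalCurve n v) :
    (1 : ZMod n) ≠ 0 := by
  have := hv.three_le
  have : Fact (1 < n) := ⟨by omega⟩
  exact _root_.one_ne_zero

lemma IsSimpleClosedPolygonalCurve.two_ne_zero (hv : IsSimpleClosedPolygonalCurve n v) :
    (2 : ZMod n) ≠ 0 := by
  have h3 := hv.three_le
  intro h
  have h2 : ((2 : ℕ) : ZMod n) = 0 := by exact_mod_cast h
  rw [ZMod.natCast_eq_zero_iff] at h2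
  exact absurd (Nat.le_of_dvd (by norm_num) h2) (by omega)

lemma IsSimpleClosedPolygonalCurve.finite (hv : IsSimpleClosedPolygonalCurve n v) :
    Finite (ZMod n) := by
  have := hv.three_le
  have : NeZero n := ⟨by omega⟩
  infer_instance

lemma IsSimpleClosedPolygonalCurve.len_pos (hv : IsSimpleClosedPolygonalCurve n v)
    (f : ZMod n × Bool) : 0 < len v f := by
  rw [len, norm_pos_iff, sub_ne_zero]
  obtain ⟨i, _ | _⟩ := f <;> simp only [head, tail, cond_true, cond_false]
  · exact fun h => hv.one_ne_zero (by simpa using hv.injective h)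
  · exact fun h => hv.one_ne_zero (by simpa using hv.injective h)

lemma IsSimpleClosedPolygonalCurve.norm_dir (hv : IsSimpleClosedPolygonalCurve n v)
    (f : ZMod n × Bool) : ‖dir v f‖ = 1 := by
  have := hv.len_pos f
  rw [dir, norm_smul, norm_inv, Real.norm_of_nonneg this.le]
  exact inv_mul_cancel₀ this.ne'

lemma IsSimpleClosedPolygonalCurve.len_smul_dir (hv : IsSimpleClosedPolygonalCurve n v)
    (f : ZMod n × Bool) : len v f • dir v f = head v f - tail v f := by
  rw [dir, smul_smul, mul_inv_cancel₀ (hv.len_pos f).ne', one_smul]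

lemma edge_eq_segment (f : ZMod n × Bool) : edge v f.1 = segment ℝ (tail v f) (head v f) := by
  obtain ⟨i, _ | _⟩ := f
  · simp [edge, tail, head, segment_symm]
  · simp [edge, tail, head]

lemma IsSimpleClosedPolygonalCurve.mem_edge_iff (hv : IsSimpleClosedPolygonalCurve n v)
    (f : ZMod n × Bool) {q : Plane} :
    q ∈ edge v f.1 ↔ ∃ x ∈ Icc 0 (len v f), q = tail v f + x • dir v f := by
  have hl := hv.len_pos f
  rw [edge_eq_segment, segment_eq_image']
  constructor
  · rintro ⟨t, ht, rfl⟩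
    refine ⟨t * len v f, ⟨mul_nonneg ht.1 hl.le, by nlinarith [ht.2]⟩, ?_⟩
    rw [mul_smul, hv.len_smul_dir]
  · rintro ⟨x, hx, rfl⟩
    refine ⟨x / len v f, ⟨div_nonneg hx.1 hl.le, (div_le_one hl).2 hx.2⟩, ?_⟩
    simp only
    rw [← hv.len_smul_dir, smul_smul, div_mul_cancel₀ _ hl.ne']

lemma isCompact_edge (i : ZMod n) : IsCompact (edge v i) := by
  rw [edge, ← convexHull_pair (𝕜 := ℝ)]
  exact (Set.toFinite {v i, v (i + 1)}).isCompact_convexHull ℝ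

lemma IsSimpleClosedPolygonalCurve.eq_of_mem_edges (hv : IsSimpleClosedPolygonalCurve n v)
    {i j : ZMod n} {p : Plane} (hi : p ∈ edge v i) (hj : p ∈ edge v j) :
    j = i ∨ (j = i + 1 ∧ p = v (i + 1)) ∨ (i = j + 1 ∧ p = v i) := by
  by_cases h1 : j = i
  · exact Or.inl h1
  by_cases h2 : j = i + 1
  · subst h2
    have : p ∈ edge v i ∩ edge v (i + 1) := ⟨hi, hj⟩
    rw [hv.consecutive] at this
    exact Or.inr (Or.inl ⟨rfl, this⟩)
  by_cases h3 : i = j + 1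
  · subst h3
    have : p ∈ edge v j ∩ edge v (j + 1) := ⟨hj, hi⟩
    rw [hv.consecutive] at this
    exact Or.inr (Or.inr ⟨rfl, this⟩)
  · exact absurd hj (Set.disjoint_left.1 (hv.nonconsecutive i j h1 h2 h3) hi)

/-- A point of a half-open edge lies on that edge only, or it is the initial vertex. -/
lemma IsSimpleClosedPolygonalCurve.eq_or_mate (hv : IsSimpleClosedPolygonalCurve n v)
    (f : ZMod n × Bool) {x : ℝ} (hx0 : 0 ≤ x) (hx : x < len v f) {j : ZMod n}
    (hj : tail v f + x • dir v f ∈ edge v j) : j = f.1 ∨ (j = (mate f).1 ∧ x = 0) := by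
  have he := hv.norm_dir f
  have hd0 : dir v f ≠ 0 := by rw [← norm_pos_iff, he]; exact one_pos
  have hi : tail v f + x • dir v f ∈ edge v f.1 := (hv.mem_edge_iff f).2 ⟨x, ⟨hx0, hx.le⟩, rfl⟩
  have htail : tail v f + x • dir v f = tail v f → x = 0 := by
    intro h
    have : x • dir v f = 0 := by simpa using h
    exact (smul_eq_zero.1 this).resolve_right hd0
  have hhead : tail v f + x • dir v f ≠ head v f := by
    intro h
    have h1 : x • dir v f = len v f • dir v f := by
      rw [hv.len_smul_dir, ← h]; abel
    exact hx.ne (smul_left_injective ℝ hd0 h1)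
  rcases hv.eq_of_mem_edges hi hj with h | ⟨h1, h2⟩ | ⟨h1, h2⟩
  · exact Or.inl h
  · right
    obtain ⟨i, _ | _⟩ := f
    · exact ⟨h1, htail h2⟩
    · exact absurd h2 hhead
  · right
    obtain ⟨i, _ | _⟩ := f
    · exact absurd h2 hhead
    · exact ⟨by simp only at h1; simp [mate, h1], htail h2⟩

lemma IsSimpleClosedPolygonalCurve.mate_fst_ne (hv : IsSimpleClosedPolygonalCurve n v)
    (f : ZMod n × Bool) : (mate f).1 ≠ f.1 := by
  obtain ⟨i, _ | _⟩ := f <;> simp [mate, hv.one_ne_zero]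

/-- Consecutive edges with the same direction from their common vertex would overlap in a segment.
-/
lemma IsSimpleClosedPolygonalCurve.dir_mate_ne (hv : IsSimpleClosedPolygonalCurve n v)
    (f : ZMod n × Bool) : dir v (mate f) ≠ dir v f := by
  intro h
  have h1 := hv.len_pos f
  have h2 := hv.len_pos (mate f)
  set x := min (len v f) (len v (mate f)) / 2 with hx
  have hx0 : 0 < x := half_pos (lt_min h1 h2)
  have hx1 : x < len v f := by
    have := min_le_left (len v f) (len v (mate f)); linarith
  have hx2 : x < len v (mate f) := by
    have := min_le_right (len v f) (len v (mate f)); linarith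
  have hm : tail v f + x • dir v f ∈ edge v (mate f).1 :=
    (hv.mem_edge_iff (mate f)).2 ⟨x, ⟨hx0.le, hx2.le⟩, by rw [tail_mate, h]⟩
  rcases hv.eq_or_mate f hx0.le hx1 hm with h3 | h3
  · exact hv.mate_fst_ne f h3
  · exact hx0.ne' h3.2

/-- The two edges at a vertex are either transversal or opposite. -/
lemma IsSimpleClosedPolygonalCurve.cross_ne_zero_or (hv : IsSimpleClosedPolygonalCurve n v)
    (f : ZMod n × Bool) :
    cross (dir v f) (dir v (mate f)) ≠ 0 ∨ dir v (mate f) = -dir v f := by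
  by_cases h : cross (dir v f) (dir v (mate f)) = 0
  · right
    have h1 := eq_smul_of_cross_eq_zero (hv.norm_dir f) (a := dir v (mate f))
      (by rw [cross_swap, h, neg_zero])
    have h2 := hv.norm_dir (mate f)
    rw [h1, norm_smul, hv.norm_dir f, mul_one, Real.norm_eq_abs, abs_eq zero_le_one] at h2
    rcases h2 with h2 | h2
    · rw [h2, one_smul] at h1
      exact absurd h1 (hv.dir_mate_ne f)
    · rw [h1, h2, neg_one_smul]
  · exact Or.inl h

lemma IsSimpleClosedPolygonalCurve.exists_dist_lt (hv : IsSimpleClosedPolygonalCurve n v)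
    (f : ZMod n × Bool) {x : ℝ} (hx0 : 0 ≤ x) (hx : x < len v f) :
    ∃ r > 0, ∀ q, dist q (tail v f + x • dir v f) < r → ∀ j, q ∈ edge v j →
      j = f.1 ∨ (j = (mate f).1 ∧ x = 0) := by
  have := hv.finite
  set p := tail v f + x • dir v f
  have hK : IsClosed (⋃ j ∈ {j | p ∉ edge v j}, edge v j) :=
    (toFinite _).isClosed_biUnion fun j _ => (isCompact_edge j).isClosed
  have hpK : p ∉ ⋃ j ∈ {j | p ∉ edge v j}, edge v j := by
    simp
  obtain ⟨r, hr, hrK⟩ := Metric.isOpen_iff.1 hK.isOpen_compl p hpK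
  refine ⟨r, hr, fun q hq j hj => ?_⟩
  by_cases hpj : p ∈ edge v j
  · exact hv.eq_or_mate f hx0 hx hpj
  · exact absurd (mem_biUnion (show j ∈ {j | p ∉ edge v j} from hpj) hj) (hrK hq)

end Simple

variable {n : ℕ} {v : ZMod n → Plane} {M : Set Plane}

/-! ### The boundary near an edge point and near a vertex -/

lemma IsPolygon.mem_frontier_iff (hM : IsPolygon n v M) {q : Plane} :
    q ∈ frontier M ↔ ∃ j, q ∈ edge v j := by
  rw [hM.frontier_eq, mem_iUnion]

lemma IsPolygon.exists_ball_edge (hM : IsPolygon n v M) (f : ZMod n × Bool) {x : ℝ} (hx0 : 0 < x)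
    (hx : x < len v f) : ∃ r > 0, ∀ q, dist q (tail v f + x • dir v f) < r →
      (q ∈ frontier M ↔ cross (q - (tail v f + x • dir v f)) (dir v f) = 0) := by
  obtain ⟨r, hr, h⟩ := hM.isSimple.exists_dist_lt f hx0.le hx
  have he := hM.isSimple.norm_dir f
  refine ⟨min r (min x (len v f - x)), lt_min hr (lt_min hx0 (sub_pos.2 hx)), fun q hq => ?_⟩
  rw [lt_min_iff, lt_min_iff] at hq
  rw [hM.mem_frontier_iff]
  constructor
  · rintro ⟨j, hj⟩
    rcases h q hq.1 j hj with rfl | h1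
    · obtain ⟨y, -, rfl⟩ := (hM.isSimple.mem_edge_iff f).1 hj
      rw [add_sub_add_left_eq_sub, ← sub_smul, cross_smul_left, cross_self, mul_zero]
    · exact absurd h1.2 hx0.ne'
  · intro hc
    have h1 := eq_smul_of_cross_eq_zero he hc
    set s := dot (q - (tail v f + x • dir v f)) (dir v f)
    have hs : |s| < min x (len v f - x) := by
      rw [lt_min_iff]
      have : |s| = dist q (tail v f + x • dir v f) := by
        rw [dist_eq_norm, h1, norm_smul, he, mul_one, Real.norm_eq_abs]
      rw [this]; exact hq.2
    rw [lt_min_iff, abs_lt, abs_lt] at hs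
    refine ⟨f.1, (hM.isSimple.mem_edge_iff f).2 ⟨x + s, ⟨by linarith, by linarith⟩, ?_⟩⟩
    rw [add_smul, ← h1]; abel

lemma IsPolygon.exists_ball_vertex (hM : IsPolygon n v M) (f : ZMod n × Bool) :
    ∃ r > 0, ∀ q, dist q (tail v f) < r →
      (q ∈ frontier M ↔ (∃ x : ℝ, 0 ≤ x ∧ q = tail v f + x • dir v f) ∨
        ∃ x : ℝ, 0 ≤ x ∧ q = tail v f + x • dir v (mate f)) := by
  have hl := hM.isSimple.len_pos f
  have hl' := hM.isSimple.len_pos (mate f)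
  obtain ⟨r, hr, h⟩ := hM.isSimple.exists_dist_lt f le_rfl hl
  rw [zero_smul, add_zero] at h
  refine ⟨min r (min (len v f) (len v (mate f))), lt_min hr (lt_min hl hl'), fun q hq => ?_⟩
  rw [lt_min_iff, lt_min_iff] at hq
  rw [hM.mem_frontier_iff]
  have key : ∀ g : ZMod n × Bool, ∀ x, 0 ≤ x → dist (tail v g + x • dir v g) (tail v g) = x := by
    intro g x hx
    rw [dist_eq_norm, add_sub_cancel_left, norm_smul, hM.isSimple.norm_dir, mul_one,
      Real.norm_of_nonneg hx]
  constructor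
  · rintro ⟨j, hj⟩
    rcases h q hq.1 j hj with rfl | ⟨rfl, -⟩
    · obtain ⟨y, hy, rfl⟩ := (hM.isSimple.mem_edge_iff f).1 hj
      exact Or.inl ⟨y, hy.1, rfl⟩
    · obtain ⟨y, hy, rfl⟩ := (hM.isSimple.mem_edge_iff (mate f)).1 hj
      exact Or.inr ⟨y, hy.1, by rw [tail_mate]⟩
  · rintro (⟨x, hx, rfl⟩ | ⟨x, hx, rfl⟩)
    · rw [key f x hx] at hq
      exact ⟨f.1, (hM.isSimple.mem_edge_iff f).2 ⟨x, ⟨hx, hq.2.1.le⟩, rfl⟩⟩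
    · rw [← tail_mate v f, key (mate f) x hx] at hq
      exact ⟨(mate f).1, (hM.isSimple.mem_edge_iff (mate f)).2
        ⟨x, ⟨hx, hq.2.2.le⟩, by rw [tail_mate]⟩⟩

/-! ### Local sides of the boundary -/

lemma convex_pos_of_affine {g : Plane → ℝ}
    (hg : ∀ x y (a b : ℝ), a + b = 1 → g (a • x + b • y) = a * g x + b * g y) :
    Convex ℝ {q | 0 < g q} := by
  intro x hx y hy a b ha hb hab
  simp only [mem_ofPred_eq] at hx hy ⊢
  rw [hg x y a b hab]
  rcases ha.eq_or_lt with rfl | ha'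
  · have : b = 1 := by linarith
    subst this; simpa using hy
  · have := mul_pos ha' hx
    have := mul_nonneg hb hy.le
    linarith

lemma dot_sub_affine (p ν x y : Plane) (a b : ℝ) (hab : a + b = 1) :
    dot (a • x + b • y - p) ν = a * dot (x - p) ν + b * dot (y - p) ν := by
  obtain rfl : b = 1 - a := by linarith
  simp [dot]; ring

lemma cross_sub_affine (c : ℝ) (p ν x y : Plane) (a b : ℝ) (hab : a + b = 1) :
    c * cross (a • x + b • y - p) ν = a * (c * cross (x - p) ν) + b * (c * cross (y - p) ν) := by
  obtain rfl : b = 1 - a := by linarith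
  simp [cross]; ring

/-- The half disc with centre `p` and radius `r` to which `ν` points. -/
def halfDisc (p ν : Plane) (r : ℝ) : Set Plane := Metric.ball p r ∩ {q | 0 < dot (q - p) ν}

/-- The convex circular sector at `p` spanned by two linearly independent vectors. -/
def sector (p e e' : Plane) (r : ℝ) : Set Plane :=
  Metric.ball p r ∩ ({q | 0 < cross e e' * cross (q - p) e'} ∩
    {q | 0 < (-cross e e') * cross (q - p) e})

/-- The complementary sector. -/
def reflexSector (p e e' : Plane) (r : ℝ) : Set Plane :=
  (Metric.ball p r ∩ {q | 0 < (-cross e e') * cross (q - p) e'}) ∪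
    (Metric.ball p r ∩ {q | 0 < cross e e' * cross (q - p) e})

lemma isOpen_cross_pos (c : ℝ) (p ν : Plane) : IsOpen {q | 0 < c * cross (q - p) ν} :=
  isOpen_lt continuous_const
    (continuous_const.mul ((continuous_cross_left ν).comp (by fun_prop)))

lemma isOpen_halfDisc (p ν : Plane) (r : ℝ) : IsOpen (halfDisc p ν r) :=
  Metric.isOpen_ball.inter
    (isOpen_lt continuous_const ((continuous_dot_left ν).comp (by fun_prop)))

lemma isPreconnected_halfDisc (p ν : Plane) (r : ℝ) : IsPreconnected (halfDisc p ν r) :=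
  ((convex_ball p r).inter (convex_pos_of_affine (dot_sub_affine p ν))).isPreconnected

lemma isOpen_sector (p e e' : Plane) (r : ℝ) : IsOpen (sector p e e' r) :=
  Metric.isOpen_ball.inter ((isOpen_cross_pos _ p e').inter (isOpen_cross_pos _ p e))

lemma isOpen_reflexSector (p e e' : Plane) (r : ℝ) : IsOpen (reflexSector p e e' r) :=
  (Metric.isOpen_ball.inter (isOpen_cross_pos _ p e')).union
    (Metric.isOpen_ball.inter (isOpen_cross_pos _ p e))

lemma isPreconnected_sector (p e e' : Plane) (r : ℝ) : IsPreconnected (sector p e e' r) :=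
  ((convex_ball p r).inter ((convex_pos_of_affine (cross_sub_affine _ p e')).inter
    (convex_pos_of_affine (cross_sub_affine _ p e)))).isPreconnected

lemma eventually_add_smul_mem_ball {p q w : Plane} {r : ℝ} (hq : dist q p < r) :
    ∀ᶠ t : ℝ in 𝓝[>] 0, q + t • w ∈ Metric.ball p r := by
  have hc : ContinuousAt (fun t : ℝ => q + t • w) 0 := by fun_prop
  refine nhdsWithin_le_nhds (hc.eventually_mem (Metric.isOpen_ball.mem_nhds ?_))
  simpa using hq

lemma mem_closure_of_eventually {q w : Plane} {S : Set Plane}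
    (h : ∀ᶠ t : ℝ in 𝓝[>] 0, q + t • w ∈ S) : q ∈ closure S := by
  have hc : Tendsto (fun t : ℝ => q + t • w) (𝓝[>] 0) (𝓝 q) := by
    have : ContinuousAt (fun t : ℝ => q + t • w) 0 := by fun_prop
    have h2 := this.tendsto
    rw [zero_smul, add_zero] at h2
    exact h2.mono_left nhdsWithin_le_nhds
  exact mem_closure_of_tendsto hc h

lemma eventually_mem_halfDisc {p ν q w : Plane} {r : ℝ} (hq : dist q p < r)
    (h0 : 0 ≤ dot (q - p) ν) (hw : 0 < dot w ν) :
    ∀ᶠ t : ℝ in 𝓝[>] 0, q + t • w ∈ halfDisc p ν r := by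
  filter_upwards [eventually_add_smul_mem_ball hq, self_mem_nhdsWithin] with t h1 h2
  refine ⟨h1, ?_⟩
  rw [mem_ofPred_eq, add_sub_right_comm, dot_add_left, dot_smul_left]
  have := mul_pos h2 hw
  linarith

lemma eventually_mem_sector {p e e' q w : Plane} {r : ℝ} (hq : dist q p < r)
    (h0 : 0 ≤ cross e e' * cross (q - p) e') (h0' : 0 ≤ (-cross e e') * cross (q - p) e)
    (hw : 0 < cross e e' * cross w e' ∨ 0 < cross e e' * cross (q - p) e')
    (hw' : 0 < (-cross e e') * cross w e ∨ 0 < (-cross e e') * cross (q - p) e) :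
    ∀ᶠ t : ℝ in 𝓝[>] 0, q + t • w ∈ sector p e e' r := by
  have key : ∀ (c : ℝ) (ε : Plane), 0 ≤ c * cross (q - p) ε →
      (0 < c * cross w ε ∨ 0 < c * cross (q - p) ε) →
      ∀ᶠ t : ℝ in 𝓝[>] 0, 0 < c * cross (q + t • w - p) ε := by
    rintro c ε h1 (h2 | h2)
    · filter_upwards [self_mem_nhdsWithin] with t ht
      rw [add_sub_right_comm, cross_add_left, cross_smul_left]
      have := mul_pos ht h2
      linarith
    · have hc : ContinuousAt (fun t : ℝ => c * cross (q + t • w - p) ε) 0 := by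
        refine (continuous_const.mul ((continuous_cross_left ε).comp ?_)).continuousAt
        fun_prop
      refine nhdsWithin_le_nhds (hc.eventually_const_lt (by simpa using h2))
  filter_upwards [eventually_add_smul_mem_ball hq, key _ _ h0 hw, key _ _ h0' hw'] with t h1 h2 h3
  exact ⟨h1, h2, h3⟩

/-- The two half discs share the points just beyond `p` in the direction `-(e + e')`. -/
lemma isPreconnected_reflexSector {p e e' : Plane} (h : cross e e' ≠ 0) {r : ℝ} (hr : 0 < r) :
    IsPreconnected (reflexSector p e e' r) := by
  have hk : 0 < cross e e' * cross e e' := mul_self_pos.2 h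
  obtain ⟨t, ht, ht0⟩ := ((eventually_add_smul_mem_ball (p := p) (q := p) (r := r) (w := -(e + e'))
    (by simpa using hr)).and self_mem_nhdsWithin).exists
  have ht0 : 0 < t := ht0
  refine IsPreconnected.union (p + t • -(e + e')) ⟨ht, ?_⟩ ⟨ht, ?_⟩
    ((convex_ball p r).inter (convex_pos_of_affine (cross_sub_affine _ p e'))).isPreconnected
    ((convex_ball p r).inter (convex_pos_of_affine (cross_sub_affine _ p e))).isPreconnected
  · rw [mem_ofPred_eq]
    have : -cross e e' * cross (p + t • -(e + e') - p) e' = t * (cross e e' * cross e e') := by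
      simp [cross]; ring
    rw [this]; exact mul_pos ht0 hk
  · rw [mem_ofPred_eq]
    have : cross e e' * cross (p + t • -(e + e') - p) e = t * (cross e e' * cross e e') := by
      simp [cross]; ring
    rw [this]; exact mul_pos ht0 hk

lemma cross_neg_left (a b : Plane) : cross (-a) b = -cross a b := by simp [cross]; ring

lemma sector_comm (p e e' : Plane) (r : ℝ) : sector p e e' r = sector p e' e r := by
  rw [sector, sector, inter_comm {q | 0 < cross e e' * cross (q - p) e'}, cross_swap e e', neg_neg]

lemma IsPolygon.exists_sector_sides (hM : IsPolygon n v M) (f : ZMod n × Bool)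
    (hf : cross (dir v f) (dir v (mate f)) ≠ 0) :
    ∃ r > 0, Disjoint (sector (tail v f) (dir v f) (dir v (mate f)) r) (frontier M) ∧
      Disjoint (reflexSector (tail v f) (dir v f) (dir v (mate f)) r) (frontier M) ∧
      (∀ q, dist q (tail v f) < r → q ∈ frontier M ∨
        q ∈ sector (tail v f) (dir v f) (dir v (mate f)) r ∨
        q ∈ reflexSector (tail v f) (dir v f) (dir v (mate f)) r) ∧
      ∀ q ∈ frontier M, dist q (tail v f) < r →
        q ∈ closure (sector (tail v f) (dir v f) (dir v (mate f)) r) ∧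
        q ∈ closure (reflexSector (tail v f) (dir v f) (dir v (mate f)) r) := by
  obtain ⟨r, hr, h⟩ := hM.exists_ball_vertex f
  set e := dir v f
  set e' := dir v (mate f)
  set p := tail v f
  have hk : 0 < cross e e' * cross e e' := mul_self_pos.2 hf
  have he : ∀ x : ℝ, cross (p + x • e - p) e = 0 ∧ cross (p + x • e - p) e' = x * cross e e' := by
    intro x
    rw [add_sub_cancel_left, cross_smul_left, cross_smul_left]; simp
  have he' : ∀ x : ℝ, cross (p + x • e' - p) e' = 0 ∧
      cross (p + x • e' - p) e = x * -cross e e' := by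
    intro x
    rw [add_sub_cancel_left, cross_smul_left, cross_smul_left, cross_swap e' e]; simp
  refine ⟨r, hr, ?_, ?_, ?_, ?_⟩
  · rw [Set.disjoint_left]
    rintro q ⟨hb, h1, h2⟩ hq
    rw [mem_ofPred_eq] at h1 h2
    rcases (h q hb).1 hq with ⟨x, hx, rfl⟩ | ⟨x, hx, rfl⟩
    · rw [(he x).1, mul_zero] at h2; exact lt_irrefl _ h2
    · rw [(he' x).1, mul_zero] at h1; exact lt_irrefl _ h1
  · rw [Set.disjoint_left]
    rintro q (⟨hb, h1⟩ | ⟨hb, h1⟩) hq <;> rw [mem_ofPred_eq] at h1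
    · rcases (h q hb).1 hq with ⟨x, hx, rfl⟩ | ⟨x, hx, rfl⟩
      · rw [(he x).2] at h1; nlinarith
      · rw [(he' x).1, mul_zero] at h1; exact lt_irrefl _ h1
    · rcases (h q hb).1 hq with ⟨x, hx, rfl⟩ | ⟨x, hx, rfl⟩
      · rw [(he x).1, mul_zero] at h1; exact lt_irrefl _ h1
      · rw [(he' x).2] at h1; nlinarith
  · intro q hq
    rw [h q hq]
    by_cases h1 : 0 < (-cross e e') * cross (q - p) e'
    · exact Or.inr (Or.inr (Or.inl ⟨hq, h1⟩))
    by_cases h2 : 0 < cross e e' * cross (q - p) e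
    · exact Or.inr (Or.inr (Or.inr ⟨hq, h2⟩))
    -- Outside the reflex sector both coordinates of `q - p` in the basis `e`, `e'` are nonnegative.
    -- A vanishing coordinate puts `q` on an edge ray; otherwise `q` is in the convex sector.
    have hdec := cross_smul_eq e e' (q - p)
    have hdiv : ∀ x, 0 ≤ cross e e' * x → 0 ≤ x / cross e e' := by
      intro x hx
      rw [← mul_div_mul_left x _ hf]
      exact div_nonneg hx hk.le
    by_cases h3 : cross (q - p) e' = 0
    · left; right
      refine ⟨cross e (q - p) / cross e e', ?_, ?_⟩
      · refine hdiv _ ?_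
        rw [cross_swap e (q - p)]; linarith
      · rw [h3, zero_smul, zero_add] at hdec
        rw [div_eq_inv_mul, mul_smul, ← hdec, smul_smul, inv_mul_cancel₀ hf, one_smul]; abel
    by_cases h4 : cross (q - p) e = 0
    · left; left
      refine ⟨cross (q - p) e' / cross e e', ?_, ?_⟩
      · refine hdiv _ ?_
        linarith
      · rw [cross_swap e (q - p), h4, neg_zero, zero_smul, add_zero] at hdec
        rw [div_eq_inv_mul, mul_smul, ← hdec, smul_smul, inv_mul_cancel₀ hf, one_smul]; abel
    · right; left
      refine ⟨hq, ?_, ?_⟩ <;> rw [mem_ofPred_eq]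
      · have := mul_ne_zero hf h3
        exact lt_of_le_of_ne (by linarith) this.symm
      · have := mul_ne_zero hf h4
        exact lt_of_le_of_ne (by linarith) (by rw [neg_mul]; exact (neg_ne_zero.2 this).symm)
  · intro q hq hqb
    have hr1 : ∀ (c : ℝ) (ε w : Plane), cross (q - p) ε = 0 → 0 < c * cross w ε →
        ∀ᶠ t : ℝ in 𝓝[>] 0, q + t • w ∈ Metric.ball p r ∩ {q | 0 < c * cross (q - p) ε} := by
      intro c ε w h0 hw
      filter_upwards [eventually_add_smul_mem_ball hqb, self_mem_nhdsWithin] with t h1 h2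
      refine ⟨h1, ?_⟩
      rw [mem_ofPred_eq, add_sub_right_comm, cross_add_left, cross_smul_left, h0, zero_add]
      have := mul_pos h2 hw
      linarith
    constructor
    · apply mem_closure_of_eventually (w := e + e')
      have h5 : 0 < cross e e' * cross (e + e') e' := by rw [cross_add_left]; simpa using hf
      have h6 : 0 < -cross e e' * cross (e + e') e := by
        rw [cross_add_left, cross_swap e' e]; simpa using hf
      rcases (h q hqb).1 hq with ⟨x, hx, rfl⟩ | ⟨x, hx, rfl⟩
      · refine eventually_mem_sector hqb ?_ ?_ (Or.inl h5) (Or.inl h6)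
        · rw [(he x).2]; nlinarith
        · rw [(he x).1, mul_zero]
      · refine eventually_mem_sector hqb ?_ ?_ (Or.inl h5) (Or.inl h6)
        · rw [(he' x).1, mul_zero]
        · rw [(he' x).2]; nlinarith
    · rcases (h q hqb).1 hq with ⟨x, hx, rfl⟩ | ⟨x, hx, rfl⟩
      · apply mem_closure_of_eventually (w := -e')
        filter_upwards [hr1 (cross e e') e (-e') (he x).1
          (by rw [cross_neg_left, cross_swap e' e]; simpa using hf)] with t ht
        exact Or.inr ht
      · apply mem_closure_of_eventually (w := -e)
        filter_upwards [hr1 (-cross e e') e' (-e) (he' x).1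
          (by rw [cross_neg_left]; simpa using hf)] with t ht
        exact Or.inl ht

lemma halfDisc_sides {p e : Plane} {r : ℝ} (he : ‖e‖ = 1)
    (h : ∀ q, dist q p < r → (q ∈ frontier M ↔ cross (q - p) e = 0)) :
    (∀ ν, ν = perp e ∨ ν = -perp e → Disjoint (halfDisc p ν r) (frontier M)) ∧
    (∀ q, dist q p < r → q ∈ frontier M ∨ q ∈ halfDisc p (perp e) r ∨
      q ∈ halfDisc p (-perp e) r) ∧
    ∀ q ∈ frontier M, dist q p < r → ∀ ν, ν = perp e ∨ ν = -perp e →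
      q ∈ closure (halfDisc p ν r) := by
  have hneg : ∀ x, dot x (-perp e) = cross x e := by
    intro x; rw [← neg_one_smul ℝ, dot_smul_right, dot_perp]; ring
  have hν : ∀ ν, ν = perp e ∨ ν = -perp e → ∀ x, cross x e = 0 → dot x ν = 0 := by
    rintro ν (rfl | rfl) x hx
    · rw [dot_perp, hx, neg_zero]
    · rw [hneg, hx]
  refine ⟨?_, ?_, ?_⟩
  · intro ν hνe
    rw [Set.disjoint_left]
    rintro q ⟨hb, h1⟩ hq
    rw [mem_ofPred_eq, hν ν hνe _ ((h q hb).1 hq)] at h1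
    exact lt_irrefl _ h1
  · intro q hq
    rw [h q hq]
    rcases lt_trichotomy (cross (q - p) e) 0 with h1 | h1 | h1
    · right; left
      exact ⟨hq, by rw [mem_ofPred_eq, dot_perp]; linarith⟩
    · exact Or.inl h1
    · right; right
      exact ⟨hq, by rw [mem_ofPred_eq, hneg]; exact h1⟩
  · intro q hq hqb ν hνe
    apply mem_closure_of_eventually (w := ν)
    refine eventually_mem_halfDisc hqb (hν ν hνe _ ((h q hqb).1 hq)).ge ?_
    rw [← norm_sq_eq_dot]
    rcases hνe with rfl | rfl <;> simp [norm_perp, he]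

/-- The sides are half discs at edge points and at vertices with opposite edge directions, and the
two sectors at all other vertices. -/
lemma IsPolygon.exists_sides (hM : IsPolygon n v M) {p : Plane} (hp : p ∈ frontier M) :
    ∃ r > 0, ∃ S₁ S₂ : Set Plane, IsOpen S₁ ∧ IsOpen S₂ ∧ IsPreconnected S₁ ∧ IsPreconnected S₂ ∧
      Disjoint S₁ (frontier M) ∧ Disjoint S₂ (frontier M) ∧
      (∀ q, dist q p < r → q ∈ frontier M ∨ q ∈ S₁ ∨ q ∈ S₂) ∧
      ∀ q ∈ frontier M, dist q p < r → q ∈ closure S₁ ∧ q ∈ closure S₂ := by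
  have hstraight : ∀ (p e : Plane) (r : ℝ), ‖e‖ = 1 → 0 < r →
      (∀ q, dist q p < r → (q ∈ frontier M ↔ cross (q - p) e = 0)) →
      ∃ r > 0, ∃ S₁ S₂ : Set Plane, IsOpen S₁ ∧ IsOpen S₂ ∧ IsPreconnected S₁ ∧
        IsPreconnected S₂ ∧ Disjoint S₁ (frontier M) ∧ Disjoint S₂ (frontier M) ∧
        (∀ q, dist q p < r → q ∈ frontier M ∨ q ∈ S₁ ∨ q ∈ S₂) ∧
        ∀ q ∈ frontier M, dist q p < r → q ∈ closure S₁ ∧ q ∈ closure S₂ := by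
    intro p e r he hr h
    obtain ⟨h1, h2, h3⟩ := halfDisc_sides he h
    exact ⟨r, hr, halfDisc p (perp e) r, halfDisc p (-perp e) r, isOpen_halfDisc _ _ _,
      isOpen_halfDisc _ _ _, isPreconnected_halfDisc _ _ _, isPreconnected_halfDisc _ _ _,
      h1 _ (Or.inl rfl), h1 _ (Or.inr rfl), h2,
      fun q hq hqb => ⟨h3 q hq hqb _ (Or.inl rfl), h3 q hq hqb _ (Or.inr rfl)⟩⟩
  have hvertex : ∀ f : ZMod n × Bool, p = tail v f → ∃ r > 0, ∃ S₁ S₂ : Set Plane, IsOpen S₁ ∧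
      IsOpen S₂ ∧ IsPreconnected S₁ ∧ IsPreconnected S₂ ∧
      Disjoint S₁ (frontier M) ∧ Disjoint S₂ (frontier M) ∧
      (∀ q, dist q p < r → q ∈ frontier M ∨ q ∈ S₁ ∨ q ∈ S₂) ∧
      ∀ q ∈ frontier M, dist q p < r → q ∈ closure S₁ ∧ q ∈ closure S₂ := by
    rintro f rfl
    rcases hM.isSimple.cross_ne_zero_or f with hc | hc
    · obtain ⟨r, hr, h1, h2, h3, h4⟩ := hM.exists_sector_sides f hc
      exact ⟨r, hr, _, _, isOpen_sector _ _ _ _, isOpen_reflexSector _ _ _ _,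
        isPreconnected_sector _ _ _ _, isPreconnected_reflexSector hc hr, h1, h2, h3, h4⟩
    · obtain ⟨r, hr, h⟩ := hM.exists_ball_vertex f
      refine hstraight _ (dir v f) r (hM.isSimple.norm_dir f) hr fun q hq => ?_
      rw [h q hq, hc]
      constructor
      · rintro (⟨x, -, rfl⟩ | ⟨x, -, rfl⟩) <;> simp [cross] <;> ring
      · intro h0
        have h1 := eq_smul_of_cross_eq_zero (hM.isSimple.norm_dir f) h0
        rcases le_total 0 (dot (q - tail v f) (dir v f)) with h2 | h2
        · exact Or.inl ⟨_, h2, by rw [← h1]; abel⟩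
        · exact Or.inr ⟨_, neg_nonneg.2 h2, by rw [neg_smul_neg, ← h1]; abel⟩
  obtain ⟨j, hj⟩ := hM.mem_frontier_iff.1 hp
  obtain ⟨x, hx, hpx⟩ := (hM.isSimple.mem_edge_iff (j, true)).1 hj
  rcases hx.1.eq_or_lt with h0 | h0
  · exact hvertex (j, true) (by rw [hpx, ← h0, zero_smul, add_zero])
  rcases hx.2.eq_or_lt with h1 | h1
  · refine hvertex (opp (j, true)) ?_
    rw [hpx, h1, hM.isSimple.len_smul_dir, tail_opp]; abel
  · obtain ⟨r, hr, h⟩ := hM.exists_ball_edge (j, true) h0 h1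
    rw [← hpx] at h
    exact hstraight p _ r (hM.isSimple.norm_dir _) hr h

/-! ### The polygon lies on one side of its boundary -/

lemma IsPolygon.isPreconnected_frontier (hM : IsPolygon n v M) : IsPreconnected (frontier M) := by
  have h3 := hM.isSimple.three_le
  have : NeZero n := ⟨by omega⟩
  have h : frontier M = ⋃ k : ℕ, edge v (k : ZMod n) := by
    rw [hM.frontier_eq]
    ext q
    simp only [mem_iUnion]
    exact ⟨fun ⟨i, hi⟩ => ⟨i.val, by rwa [ZMod.natCast_zmod_val]⟩, fun ⟨k, hk⟩ => ⟨_, hk⟩⟩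
  rw [h]
  refine IsPreconnected.iUnion_of_chain (fun k => (convex_segment _ _).isPreconnected) fun k => ?_
  refine ⟨v (k + 1), right_mem_segment _ _ _, ?_⟩
  rw [Nat.succ_eq_succ, Nat.cast_succ]
  exact left_mem_segment _ _ _

lemma IsPolygon.disjoint_frontier (hM : IsPolygon n v M) : Disjoint M (frontier M) := by
  rw [hM.isOpen.frontier_eq]; exact disjoint_sdiff_right

lemma IsPolygon.mem_of_mem_closure (hM : IsPolygon n v M) {q : Plane} (hq : q ∈ closure M)
    (h : q ∉ frontier M) : q ∈ M := by
  by_contra h1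
  rw [hM.isOpen.frontier_eq] at h
  exact h ⟨hq, h1⟩

/-- A polygon lies on one side only of each of its edges. -/
lemma IsPolygon.notMem_interior_closure (hM : IsPolygon n v M) {p : Plane}
    (hp : p ∈ frontier M) : p ∉ interior (closure M) := by
  -- If `y` near `x` is interior to the closure, then `M` meets both local sides at `x` and hence
  -- contains both, so `x` is interior to the closure as well.
  have hloc : ∀ x ∈ frontier M, ∀ᶠ y in 𝓝[frontier M] x,
      (y ∈ interior (closure M) → x ∈ interior (closure M)) := by
    intro x hx
    obtain ⟨r, hr, S₁, S₂, ho₁, ho₂, hc₁, hc₂, hd₁, hd₂, hcov, hcl⟩ := hM.exists_sides hx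
    filter_upwards [self_mem_nhdsWithin, nhdsWithin_le_nhds (Metric.ball_mem_nhds x hr)]
      with y hy hyb hyi
    have key : ∀ S : Set Plane, IsOpen S → IsPreconnected S → Disjoint S (frontier M) →
        y ∈ closure S → S ⊆ M := by
      intro S ho hc hd hyS
      refine subset_of_isPreconnected hc hM.isOpen hd ?_
      obtain ⟨z, hz, hzS⟩ := mem_closure_iff.1 hyS _ isOpen_interior hyi
      obtain ⟨w, hw, hwM⟩ := mem_closure_iff.1 (interior_subset hz) _ ho hzS
      exact ⟨w, hw, hwM⟩
    have h1 := key S₁ ho₁ hc₁ hd₁ (hcl y hy hyb).1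
    have h2 := key S₂ ho₂ hc₂ hd₂ (hcl y hy hyb).2
    rw [mem_interior_iff_mem_nhds]
    filter_upwards [Metric.ball_mem_nhds x hr] with z hz
    rcases hcov z hz with h | h | h
    · exact frontier_subset_closure h
    · exact subset_closure (h1 h)
    · exact subset_closure (h2 h)
  intro hpi
  -- The property is open and closed in the connected frontier, so it spreads from `p` to all of it.
  -- The closure of `M` is then clopen in the plane, which contradicts boundedness.
  have hall : ∀ x ∈ frontier M, x ∈ interior (closure M) := by
    intro x hx
    refine (hM.isPreconnected_frontier.induction₂
      (fun x y => x ∈ interior (closure M) ↔ y ∈ interior (closure M)) ?_ ?_ ?_ hp hx).1 hpi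
    · intro x hx
      by_cases hxi : x ∈ interior (closure M)
      · filter_upwards [nhdsWithin_le_nhds (isOpen_interior.mem_nhds hxi)] with y hy
        exact ⟨fun _ => hy, fun _ => hxi⟩
      · filter_upwards [hloc x hx] with y hy
        exact ⟨fun h => absurd h hxi, hy⟩
    · intro x y z _ _ _ h1 h2; exact h1.trans h2
    · intro x y _ _ h; exact h.symm
  have hclopen : IsClopen (closure M) := by
    refine ⟨isClosed_closure, ?_⟩
    rw [← subset_interior_iff_isOpen]
    intro x hx
    by_cases hxf : x ∈ frontier M
    · exact hall x hxf
    · exact interior_mono subset_closure (by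
        rw [hM.isOpen.interior_eq]; exact hM.mem_of_mem_closure hx hxf)
  rcases isClopen_iff.1 hclopen with h | h
  · exact hM.isConnected.nonempty.closure.ne_empty h
  · have hb := hM.isBounded.closure
    rw [h] at hb
    exact NormedSpace.unbounded_univ ℝ Plane hb

/-- `ν` is the inward unit normal of the polygon along the edge of the flag `f`. -/
structure IsInward (M : Set Plane) (v : ZMod n → Plane) (f : ZMod n × Bool) (ν : Plane) : Prop where
  norm_eq : ‖ν‖ = 1
  dot_eq : dot (dir v f) ν = 0
  side : ∀ x ∈ Ioo 0 (len v f), ∃ r > 0, ∀ q, dist q (tail v f + x • dir v f) < r →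
    (0 < dot (q - (tail v f + x • dir v f)) ν → q ∈ M) ∧
    (q ∈ closure M → 0 ≤ dot (q - (tail v f + x • dir v f)) ν)

lemma IsPolygon.exists_isInward (hM : IsPolygon n v M) (f : ZMod n × Bool) :
    ∃ ν, IsInward M v f ν := by
  have he := hM.isSimple.norm_dir f
  set e := dir v f
  set P : ℝ → Plane → Prop := fun x ν => ∃ r > 0, ∀ q, dist q (tail v f + x • e) < r →
    (0 < dot (q - (tail v f + x • e)) ν → q ∈ M) ∧
    (q ∈ closure M → 0 ≤ dot (q - (tail v f + x • e)) ν) with hP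
  have hee : dot e (perp e) = 0 := by simp [dot]; ring
  have hneg : ∀ x, dot x (-perp e) = -dot x (perp e) := by
    intro x; rw [← neg_one_smul ℝ, dot_smul_right]; ring
  -- `M` contains or avoids each half disc. Containing both is excluded by
  -- `IsPolygon.notMem_interior_closure`, avoiding both by the presence of points of `M` near `p`.
  have hone : ∀ x ∈ Ioo 0 (len v f), P x (perp e) ∨ P x (-perp e) := by
    intro x hx
    obtain ⟨r, hr, h⟩ := hM.exists_ball_edge f hx.1 hx.2
    obtain ⟨h1, h2, h3⟩ := halfDisc_sides he h
    set p := tail v f + x • e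
    have hpf : p ∈ frontier M := (h p (by simpa using hr)).2 (by simp [cross])
    have hdich : ∀ ν, ν = perp e ∨ ν = -perp e →
        halfDisc p ν r ⊆ M ∨ Disjoint (halfDisc p ν r) (closure M) := by
      intro ν hν
      by_cases hne : (halfDisc p ν r ∩ M).Nonempty
      · exact Or.inl (subset_of_isPreconnected (isPreconnected_halfDisc _ _ _) hM.isOpen
          (h1 ν hν) hne)
      · exact Or.inr ((disjoint_iff_inter_eq_empty.2
          (not_nonempty_iff_eq_empty.1 hne)).closure_right (isOpen_halfDisc _ _ _))
    have hpick : ∀ ν, ν = perp e ∨ ν = -perp e → halfDisc p ν r ⊆ M →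
        Disjoint (halfDisc p (-ν) r) (closure M) → P x ν := by
      intro ν hν h5 h6
      refine ⟨r, hr, fun q hq => ⟨fun h7 => h5 ⟨hq, h7⟩, fun h7 => ?_⟩⟩
      by_contra h8
      refine Set.disjoint_left.1 h6 ⟨hq, ?_⟩ h7
      rw [mem_ofPred_eq, ← neg_one_smul ℝ, dot_smul_right]
      linarith
    rcases hdich _ (Or.inl rfl) with h5 | h5 <;> rcases hdich _ (Or.inr rfl) with h6 | h6
    · exfalso
      refine hM.notMem_interior_closure hpf (mem_interior_iff_mem_nhds.2 ?_)
      filter_upwards [Metric.ball_mem_nhds p hr] with z hz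
      rcases h2 z hz with h | h | h
      · exact frontier_subset_closure h
      · exact subset_closure (h5 h)
      · exact subset_closure (h6 h)
    · exact Or.inl (hpick _ (Or.inl rfl) h5 h6)
    · exact Or.inr (hpick _ (Or.inr rfl) h6 (by rwa [neg_neg]))
    · exfalso
      obtain ⟨w, hw, hwM⟩ := mem_closure_iff.1 (frontier_subset_closure hpf) _ Metric.isOpen_ball
        (Metric.mem_ball_self hr)
      rcases h2 w hw with h | h | h
      · exact Set.disjoint_left.1 hM.disjoint_frontier hwM h
      · exact Set.disjoint_left.1 h5 h (subset_closure hwM)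
      · exact Set.disjoint_left.1 h6 h (subset_closure hwM)
  have hnot : ∀ x, P x (perp e) → ¬ P x (-perp e) := by
    rintro x ⟨r, hr, h⟩ ⟨r', hr', h'⟩
    have hlt : dist (tail v f + x • e) (tail v f + x • e) < min r r' := by
      rw [dist_self]; exact lt_min hr hr'
    obtain ⟨t, ht, ht0⟩ := ((eventually_add_smul_mem_ball (w := perp e) hlt).and
      self_mem_nhdsWithin).exists
    have ht0 : 0 < t := ht0
    rw [Metric.mem_ball, lt_min_iff] at ht
    have hd : dot (tail v f + x • e + t • perp e - (tail v f + x • e)) (perp e) = t := by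
      rw [add_sub_cancel_left, dot_smul_left, ← norm_sq_eq_dot, norm_perp, he]; ring
    have h1 := (h _ ht.1).1 (by rw [hd]; exact ht0)
    have h2 := (h' _ ht.2).2 (subset_closure h1)
    rw [hneg, hd] at h2
    linarith
  have hnear : ∀ x, ∀ ν, dot e ν = 0 → P x ν → ∀ᶠ y in 𝓝 x, P y ν := by
    rintro x ν hν ⟨r, hr, h⟩
    filter_upwards [Metric.ball_mem_nhds x (half_pos hr)] with y hy
    refine ⟨r / 2, half_pos hr, fun q hq => ?_⟩
    have hxy : dist (tail v f + y • e) (tail v f + x • e) < r / 2 := by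
      rw [dist_add_left, dist_eq_norm, ← sub_smul, norm_smul, he, mul_one, ← dist_eq_norm]
      exact hy
    have h1 := h q (by have := dist_triangle q (tail v f + y • e) (tail v f + x • e); linarith)
    have h2 : dot (q - (tail v f + x • e)) ν = dot (q - (tail v f + y • e)) ν := by
      have : q - (tail v f + x • e) = q - (tail v f + y • e) + (y - x) • e := by
        rw [sub_smul]; abel
      rw [this, dot_add_left, dot_smul_left, hν]; ring
    rwa [h2] at h1
  have hl := hM.isSimple.len_pos f
  have hmid : len v f / 2 ∈ Ioo 0 (len v f) := ⟨half_pos hl, half_lt_self hl⟩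
  -- The two alternatives are open and mutually exclusive, so the inward side cannot switch along
  -- the connected open edge.
  have hconst : ∀ x ∈ Ioo 0 (len v f), (P (len v f / 2) (perp e) ↔ P x (perp e)) := by
    intro x hx
    refine (convex_Ioo 0 (len v f)).isPreconnected.induction₂
      (fun x y => P x (perp e) ↔ P y (perp e)) ?_ ?_ ?_ hmid hx
    · intro y hy
      rcases hone y hy with h1 | h1
      · filter_upwards [nhdsWithin_le_nhds (hnear y _ hee h1)] with z hz
        exact ⟨fun _ => hz, fun _ => h1⟩
      · filter_upwards [nhdsWithin_le_nhds (hnear y _ (by rw [hneg, hee, neg_zero]) h1)] with z hz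
        exact ⟨fun h => absurd h1 (hnot y h), fun h => absurd hz (hnot z h)⟩
    · intro x y z _ _ _ h1 h2; exact h1.trans h2
    · intro x y _ _ h; exact h.symm
  by_cases h0 : P (len v f / 2) (perp e)
  · exact ⟨perp e, by rw [norm_perp, he], hee, fun x hx => (hconst x hx).1 h0⟩
  · refine ⟨-perp e, by rw [norm_neg, norm_perp, he], by rw [hneg, hee, neg_zero], fun x hx => ?_⟩
    exact (hone x hx).resolve_left fun h => h0 ((hconst x hx).2 h)

/-! ### Convex vertices and interior angles -/

/-- The polygon `M` contains the convex sector between the two edges at the vertex of `f`. -/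
def IsConvexAt (M : Set Plane) (v : ZMod n → Plane) (f : ZMod n × Bool) : Prop :=
  cross (dir v f) (dir v (mate f)) ≠ 0 ∧
    ∃ r > 0, sector (tail v f) (dir v f) (dir v (mate f)) r ⊆ M

lemma IsConvexAt.mate {f : ZMod n × Bool} (h : IsConvexAt M v f) : IsConvexAt M v (mate f) := by
  refine ⟨?_, ?_⟩
  · rw [mate_mate, cross_swap]; exact neg_ne_zero.2 h.1
  · rw [mate_mate, tail_mate]
    obtain ⟨r, hr, hs⟩ := h.2
    exact ⟨r, hr, by rwa [sector_comm]⟩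

lemma IsPolygon.isConvexAt_of_inter_nonempty (hM : IsPolygon n v M) {f : ZMod n × Bool}
    (hf : cross (dir v f) (dir v (Escobar.mate f)) ≠ 0)
    (h : ∀ r > 0, (sector (tail v f) (dir v f) (dir v (Escobar.mate f)) r ∩ M).Nonempty) :
    IsConvexAt M v f := by
  obtain ⟨r, hr, hd, -⟩ := hM.exists_sector_sides f hf
  exact ⟨hf, r, hr, subset_of_isPreconnected (isPreconnected_sector _ _ _ _) hM.isOpen hd (h r hr)⟩

lemma IsInward.eventually_mem {f : ZMod n × Bool} {ν : Plane} (h : IsInward M v f ν) {x : ℝ}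
    (hx : x ∈ Ioo 0 (len v f)) {w : Plane} (hw : 0 < dot w ν) :
    ∀ᶠ t : ℝ in 𝓝[>] 0, tail v f + x • dir v f + t • w ∈ M := by
  obtain ⟨r, hr, hs⟩ := h.side x hx
  filter_upwards [eventually_mem_halfDisc (p := tail v f + x • dir v f) (ν := ν)
    (q := tail v f + x • dir v f) (r := r) (by simpa using hr) (by simp [dot]) hw] with t ht
  exact (hs _ ht.1).1 ht.2

lemma eventually_edge_add_mem_sector {p e e' : Plane} (h : cross e e' ≠ 0) (he : ‖e‖ = 1)
    {r x : ℝ} (hx : 0 < x) (hxr : x < r) :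
    ∀ᶠ t : ℝ in 𝓝[>] 0, p + x • e + t • e' ∈ sector p e e' r := by
  have hk : 0 < cross e e' * cross e e' := mul_self_pos.2 h
  refine eventually_mem_sector ?_ ?_ ?_ (Or.inr ?_) (Or.inl ?_)
  · rw [dist_eq_norm, add_sub_cancel_left, norm_smul, he, mul_one, Real.norm_of_nonneg hx.le]
    exact hxr
  · rw [add_sub_cancel_left, cross_smul_left]; nlinarith
  · rw [add_sub_cancel_left, cross_smul_left]; simp
  · rw [add_sub_cancel_left, cross_smul_left]; nlinarith
  · rw [cross_swap e' e]; nlinarith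

/-- A small step from an edge point along the direction of the other edge enters the convex sector;
if that direction points inward, it also enters `M`. Together with its converse below, this detects
convexity by the sign of one dot product. -/
lemma IsPolygon.isConvexAt_of_dot_pos (hM : IsPolygon n v M) {f : ZMod n × Bool} {ν : Plane}
    (hν : IsInward M v f ν) (h : 0 < dot (dir v (Escobar.mate f)) ν) : IsConvexAt M v f := by
  have hf : cross (dir v f) (dir v (Escobar.mate f)) ≠ 0 := by
    rcases hM.isSimple.cross_ne_zero_or f with hc | hc
    · exact hc
    · rw [hc, ← neg_one_smul ℝ, dot_smul_left, hν.dot_eq, mul_zero] at h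
      exact absurd h (lt_irrefl _)
  refine hM.isConvexAt_of_inter_nonempty hf fun r hr => ?_
  have hl := hM.isSimple.len_pos f
  have hm : 0 < min r (len v f) := lt_min hr hl
  have h1 : min r (len v f) / 2 < r := by linarith [min_le_left r (len v f)]
  have h2 : min r (len v f) / 2 < len v f := by linarith [min_le_right r (len v f)]
  obtain ⟨t, ht1, ht2⟩ := ((hν.eventually_mem ⟨half_pos hm, h2⟩ h).and
    (eventually_edge_add_mem_sector (p := tail v f) hf (hM.isSimple.norm_dir f)
      (half_pos hm) h1)).exists
  exact ⟨_, ht2, ht1⟩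

lemma IsPolygon.dot_pos_of_isConvexAt (hM : IsPolygon n v M) {f : ZMod n × Bool} {ν : Plane}
    (hν : IsInward M v f ν) (h : IsConvexAt M v f) : 0 < dot (dir v (Escobar.mate f)) ν := by
  obtain ⟨hf, r, hr, hs⟩ := h
  have he := hM.isSimple.norm_dir f
  have hl := hM.isSimple.len_pos f
  have hm : 0 < min r (len v f) := lt_min hr hl
  have h1 : min r (len v f) / 2 < r := by linarith [min_le_left r (len v f)]
  have h2 : min r (len v f) / 2 < len v f := by linarith [min_le_right r (len v f)]
  obtain ⟨ρ, hρ, hside⟩ := hν.side _ ⟨half_pos hm, h2⟩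
  set p := tail v f + (min r (len v f) / 2) • dir v f
  have h3 : 0 ≤ dot (dir v (Escobar.mate f)) ν := by
    obtain ⟨t, ⟨ht1, ht2⟩, ht3⟩ := ((eventually_add_smul_mem_ball (p := p) (q := p)
      (w := dir v (Escobar.mate f)) (r := ρ) (by simpa using hρ)).and
      (eventually_edge_add_mem_sector (p := tail v f) hf he (half_pos hm) h1) |>.and
        self_mem_nhdsWithin).exists
    have ht3 : 0 < t := ht3
    have h4 := (hside _ ht1).2 (subset_closure (hs ht2))
    rw [add_sub_cancel_left, dot_smul_left] at h4
    exact nonneg_of_mul_nonneg_right h4 ht3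
  refine lt_of_le_of_ne h3 fun h0 => hf ?_
  have hνn : ν ≠ 0 := by rw [← norm_pos_iff, hν.norm_eq]; exact one_pos
  have h5 : ∀ a, dot a ν = 0 → a = cross ν a • perp ν := by
    intro a ha
    conv_lhs => rw [eq_dot_smul_add_cross_smul hν.norm_eq a, ha, zero_smul, zero_add]
  rw [h5 _ hν.dot_eq, h5 _ h0.symm, cross_smul_left, cross_smul_right, cross_self]; ring

/-- The index of the vertex at which a flag starts. -/
def idx (f : ZMod n × Bool) : ZMod n := cond f.2 f.1 (f.1 + 1)

lemma angle_eq_arccos_dot {a b : Plane} (ha : ‖a‖ = 1) (hb : ‖b‖ = 1) :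
    InnerProductGeometry.angle a b = Real.arccos (dot a b) := by
  rw [InnerProductGeometry.angle, ha, hb, inner_eq_dot]; simp

lemma IsPolygon.angle_eq (hM : IsPolygon n v M) (i : ZMod n) :
    EuclideanGeometry.angle (v (i - 1)) (v i) (v (i + 1)) =
      Real.arccos (dot (dir v (i, true)) (dir v (mate (i, true)))) := by
  have h1 := hM.isSimple.len_smul_dir (i, true)
  have h2 := hM.isSimple.len_smul_dir (mate (i, true))
  rw [tail_mate] at h2
  simp only [head, tail, mate, cond_true, cond_false] at h1 h2
  rw [EuclideanGeometry.angle, vsub_eq_sub, vsub_eq_sub, ← h1, ← h2,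
    InnerProductGeometry.angle_smul_left_of_pos _ _ (hM.isSimple.len_pos _),
    InnerProductGeometry.angle_smul_right_of_pos _ _ (hM.isSimple.len_pos _),
    angle_eq_arccos_dot (hM.isSimple.norm_dir _) (hM.isSimple.norm_dir _), dot_comm]
  rfl

lemma IsPolygon.eventually_bisector_mem_sector (hM : IsPolygon n v M) (i : ZMod n)
    (hf : cross (dir v (i, true)) (dir v (mate (i, true))) ≠ 0) {r : ℝ} (hr : 0 < r) :
    ∀ᶠ t : ℝ in 𝓝[>] 0, v i + t • ((v (i - 1) - v i) + (v (i + 1) - v i)) ∈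
      sector (tail v (i, true)) (dir v (i, true)) (dir v (mate (i, true))) r := by
  have h1 := hM.isSimple.len_smul_dir (i, true)
  have h2 := hM.isSimple.len_smul_dir (mate (i, true))
  have hl1 := hM.isSimple.len_pos (i, true)
  have hl2 := hM.isSimple.len_pos (mate (i, true))
  rw [tail_mate] at h2
  have hk : 0 < cross (dir v (i, true)) (dir v (mate (i, true))) *
    cross (dir v (i, true)) (dir v (mate (i, true))) := mul_self_pos.2 hf
  have h1' : v (i + 1) - v i = len v (i, true) • dir v (i, true) := h1.symm
  have h2' : v (i - 1) - v i = len v (mate (i, true)) • dir v (mate (i, true)) := h2.symm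
  rw [h1', h2']
  refine eventually_mem_sector (q := v i) (by simpa [tail] using hr) ?_ ?_ (Or.inl ?_) (Or.inl ?_)
  · simp [tail, cross]
  · simp [tail, cross]
  · rw [cross_add_left, cross_smul_left, cross_smul_left, cross_self]
    have := mul_pos hl1 hk
    linarith
  · rw [cross_add_left, cross_smul_left, cross_smul_left, cross_self,
      cross_swap (dir v (mate (i, true)))]
    have := mul_pos hl2 hk
    linarith

lemma IsPolygon.interiorAngle_of_isConvexAt (hM : IsPolygon n v M) {f : ZMod n × Bool}
    (h : IsConvexAt M v f) :
    interiorAngle M v (idx f) = Real.arccos (dot (dir v f) (dir v (Escobar.mate f))) := by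
  have key : ∀ i : ZMod n, IsConvexAt M v (i, true) → interiorAngle M v i =
      Real.arccos (dot (dir v (i, true)) (dir v (Escobar.mate (i, true)))) := by
    rintro i ⟨hf, r, hr, hs⟩
    rw [interiorAngle, if_pos, hM.angle_eq]
    filter_upwards [hM.eventually_bisector_mem_sector i hf hr] with t ht
    exact hs ht
  obtain ⟨i, _ | _⟩ := f
  · have h1 := key (i + 1) h.mate
    rw [show ((i + 1, true) : ZMod n × Bool) = Escobar.mate (i, false) from rfl, mate_mate,
      dot_comm] at h1
    exact h1
  · exact key i h

lemma interiorAngle_nonneg (M : Set Plane) (v : ZMod n → Plane) (i : ZMod n) :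
    0 ≤ interiorAngle M v i := by
  rw [interiorAngle]
  split_ifs
  · exact EuclideanGeometry.angle_nonneg _ _ _
  · have := EuclideanGeometry.angle_le_pi (v (i - 1)) (v i) (v (i + 1))
    linarith [Real.pi_pos]

/-- The complementary branch of `interiorAngle` is at least `π`, and so is the angle between
opposite edge directions. What remains is a nondegenerate sector that the bisecting ray shows to
meet `M`. -/
lemma IsPolygon.isConvexAt_of_interiorAngle_lt (hM : IsPolygon n v M) {i : ZMod n}
    (h : interiorAngle M v i < π) : IsConvexAt M v (i, true) := by
  have hle := EuclideanGeometry.angle_le_pi (v (i - 1)) (v i) (v (i + 1))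
  rw [interiorAngle] at h
  split_ifs at h with hc
  · have hf : cross (dir v (i, true)) (dir v (Escobar.mate (i, true))) ≠ 0 := by
      rcases hM.isSimple.cross_ne_zero_or (i, true) with h1 | h1
      · exact h1
      · rw [hM.angle_eq, h1] at h
        have h2 : dot (dir v (i, true)) (-dir v (i, true)) = -1 := by
          rw [← neg_one_smul ℝ, dot_smul_right, dot_self_eq_one (hM.isSimple.norm_dir _)]; ring
        rw [h2, Real.arccos_neg_one] at h
        exact absurd h (lt_irrefl _)
    refine hM.isConvexAt_of_inter_nonempty hf fun r hr => ?_
    obtain ⟨t, h1, h2⟩ := (hc.and (hM.eventually_bisector_mem_sector i hf hr)).exists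
    exact ⟨_, h2, h1⟩
  · linarith

/-- At a vertex farthest from the origin the polygon is confined to a disc with that vertex on its
boundary circle, so the angle there cannot be straight or reflex. -/
lemma IsPolygon.exists_interiorAngle_lt (hM : IsPolygon n v M) :
    ∃ i, interiorAngle M v i < π := by
  have := hM.isSimple.finite
  obtain ⟨i, hi⟩ := Finite.exists_max fun i => ‖v i‖
  have hMi : ∀ x ∈ M, ‖x‖ ≤ ‖v i‖ := by
    intro x hx
    by_cases hx0 : x = 0
    · rw [hx0, norm_zero]; exact norm_nonneg _
    obtain ⟨t, ht, hf⟩ := exists_frontier_of_mem hM.isOpen hM.isBounded hx0 hx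
    obtain ⟨j, hj⟩ := hM.mem_frontier_iff.1 hf
    have h1 : x + t • x ∈ Metric.closedBall (0 : Plane) ‖v i‖ :=
      (convex_closedBall (0 : Plane) ‖v i‖).segment_subset (by simpa using hi j)
        (by simpa using hi (j + 1)) hj
    have h2 : x + t • x = (1 + t) • x := by rw [add_smul, one_smul]
    rw [mem_closedBall_zero_iff, h2, norm_smul, Real.norm_of_nonneg (by linarith)] at h1
    nlinarith [norm_nonneg x]
  set f : ZMod n × Bool := (i, true) with hfdef
  have hV : tail v f = v i := rfl
  -- The far end of the edge is also in the disc, so the edge points strictly into it; strictness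
  -- comes from the positive edge length.
  have hdot : ∀ g : ZMod n × Bool, tail v g = v i → dot (v i) (dir v g) < 0 := by
    intro g hg
    have h1 : ‖head v g‖ ≤ ‖v i‖ := by
      obtain ⟨j, _ | _⟩ := g <;> exact hi _
    have h2 : head v g = v i + len v g • dir v g := by rw [hM.isSimple.len_smul_dir, hg]; abel
    have h3 : ‖head v g‖ ^ 2 ≤ ‖v i‖ ^ 2 := pow_le_pow_left₀ (norm_nonneg _) h1 2
    have h4 := dot_self_eq_one (hM.isSimple.norm_dir g)
    have hl := hM.isSimple.len_pos g
    rw [norm_sq_eq_dot, norm_sq_eq_dot, h2, dot_add_left, dot_add_right, dot_add_right,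
      dot_smul_left, dot_smul_right, dot_smul_left, dot_smul_right, h4, dot_comm (dir v g)] at h3
    have h5 : len v g * (2 * dot (v i) (dir v g) + len v g) ≤ 0 := by linarith
    have h6 := nonpos_of_mul_nonpos_right h5 hl
    linarith
  have hd := hdot f hV
  have hd' := hdot (mate f) (by rw [tail_mate, hV])
  have hf : cross (dir v f) (dir v (mate f)) ≠ 0 := by
    rcases hM.isSimple.cross_ne_zero_or f with h1 | h1
    · exact h1
    · rw [h1, ← neg_one_smul ℝ, dot_smul_right] at hd'
      linarith
  have hV0 : v i ≠ 0 := by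
    intro h0; rw [h0] at hd; simp [dot] at hd
  have hconv : IsConvexAt M v f := by
    obtain ⟨r, hr, hd1, hd2, hcov, -⟩ := hM.exists_sector_sides f hf
    have hVf : tail v f ∈ frontier M :=
      hM.mem_frontier_iff.2 ⟨f.1, (hM.isSimple.mem_edge_iff f).2
        ⟨0, ⟨le_rfl, (hM.isSimple.len_pos f).le⟩, by simp⟩⟩
    obtain ⟨w, hw, hwM⟩ := mem_closure_iff.1 (frontier_subset_closure hVf) _ Metric.isOpen_ball
      (Metric.mem_ball_self hr)
    rcases hcov w hw with h | h | h
    · exact absurd h (Set.disjoint_left.1 hM.disjoint_frontier hwM)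
    · exact ⟨hf, r, hr, subset_of_isPreconnected (isPreconnected_sector _ _ _ _) hM.isOpen hd1
        ⟨w, h, hwM⟩⟩
    · exfalso
      have hsub := subset_of_isPreconnected (isPreconnected_reflexSector hf hr) hM.isOpen hd2
        ⟨w, h, hwM⟩
      obtain ⟨t, ht, ht0⟩ := ((eventually_add_smul_mem_ball (p := tail v f) (q := tail v f)
        (w := v i) (r := r) (by simpa using hr)).and self_mem_nhdsWithin).exists
      have ht0 : 0 < t := ht0
      have hnot : tail v f + t • v i ∉ M := by
        intro hmem
        have h1 := hMi _ hmem
        have h2 : tail v f + t • v i = (1 + t) • v i := by rw [hV, add_smul, one_smul]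
        rw [h2, norm_smul, Real.norm_of_nonneg (by linarith)] at h1
        have := norm_pos_iff.2 hV0
        nlinarith
      set e := dir v f
      set e' := dir v (mate f)
      -- The outward direction `v i` lies in the reflex sector: if both its coordinates in the basis
      -- `e`, `e'` were nonnegative, its square norm would be at most `0`.
      have hdec := congrArg (fun x => dot x (cross e e' • v i)) (cross_smul_eq e e' (v i))
      simp only [dot_add_left, dot_smul_left, dot_smul_right] at hdec
      have hk : 0 < cross e e' * cross e e' := mul_self_pos.2 hf
      have hVV : 0 < dot (v i) (v i) := by
        rw [← norm_sq_eq_dot]; exact pow_pos (norm_pos_iff.2 hV0) 2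
      rw [dot_comm e, dot_comm e', cross_swap e (v i)] at hdec
      have hor : 0 < -cross e e' * cross (v i) e' ∨ 0 < cross e e' * cross (v i) e := by
        by_contra hno
        push Not at hno
        have := mul_pos hk hVV
        have h1 := mul_nonneg_of_nonpos_of_nonpos hno.1 hd.le
        have h2 := mul_nonneg_of_nonpos_of_nonpos hno.2 hd'.le
        nlinarith
      apply hnot
      apply hsub
      rcases hor with h1 | h1
      · refine Or.inl ⟨ht, ?_⟩
        rw [mem_ofPred_eq, add_sub_cancel_left, cross_smul_left]
        have := mul_pos ht0 h1
        linarith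
      · refine Or.inr ⟨ht, ?_⟩
        rw [mem_ofPred_eq, add_sub_cancel_left, cross_smul_left]
        have := mul_pos ht0 h1
        linarith
  refine ⟨i, ?_⟩
  have h1 := hM.interiorAngle_of_isConvexAt hconv
  rw [show idx f = i from rfl] at h1
  rw [h1]
  refine lt_of_le_of_ne (Real.arccos_le_pi _) fun h2 => hf ?_
  rw [Real.arccos_eq_pi] at h2
  have h3 := sq_cross_add_sq_dot (dir v f) (dir v (mate f))
  rw [dot_self_eq_one (hM.isSimple.norm_dir _), dot_self_eq_one (hM.isSimple.norm_dir _)] at h3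
  have h4 : cross (dir v f) (dir v (mate f)) ^ 2 = 0 := by nlinarith [sq_nonneg (cross (dir v f) (dir v (mate f)))]
  exact pow_eq_zero_iff (two_ne_zero) |>.1 h4

/-! ### The directions of slicing -/

/-- The direction in which sets are sliced, starting from points of an edge near a vertex: along
the bisector of a convex vertex, and perpendicularly to the edge at the other vertices. -/
def flow (v : ZMod n → Plane) (ν : ZMod n × Bool → Plane) (f : ZMod n × Bool) : Plane :=
  open Classical in
  if 0 < dot (dir v (mate f)) (ν f) then
    ‖dir v f + dir v (mate f)‖⁻¹ • (dir v f + dir v (mate f)) else ν f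

variable {ν : ZMod n × Bool → Plane}

/-- Both conditions express convexity of the common vertex, so the two flags at a vertex take the
same branch of `flow`. -/
lemma IsPolygon.dot_mate_pos_iff (hM : IsPolygon n v M) (hν : ∀ f, IsInward M v f (ν f))
    (f : ZMod n × Bool) : 0 < dot (dir v f) (ν (mate f)) ↔ 0 < dot (dir v (mate f)) (ν f) := by
  constructor
  · intro h
    have h1 := (hM.isConvexAt_of_dot_pos (hν (mate f)) (by rwa [mate_mate])).mate
    rw [mate_mate] at h1
    exact hM.dot_pos_of_isConvexAt (hν f) h1
  · intro h
    have h1 := hM.dot_pos_of_isConvexAt (hν (mate f)) (hM.isConvexAt_of_dot_pos (hν f) h).mate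
    rwa [mate_mate] at h1

lemma add_ne_zero_of_cross {a b : Plane} (h : cross a b ≠ 0) : a + b ≠ 0 := by
  intro h0
  apply h
  have : b = -a := (neg_eq_of_add_eq_zero_right h0).symm
  rw [this]; simp [cross]; ring

lemma IsPolygon.norm_flow (hM : IsPolygon n v M) (hν : ∀ f, IsInward M v f (ν f))
    (f : ZMod n × Bool) : ‖flow v ν f‖ = 1 := by
  rw [flow]
  split_ifs with h
  · have := add_ne_zero_of_cross (hM.isConvexAt_of_dot_pos (hν f) h).1
    rw [norm_smul, norm_inv, norm_norm, inv_mul_cancel₀ (norm_ne_zero_iff.2 this)]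
  · exact (hν f).norm_eq

lemma IsPolygon.dot_flow_pos (hM : IsPolygon n v M) (hν : ∀ f, IsInward M v f (ν f))
    (f : ZMod n × Bool) : 0 < dot (flow v ν f) (ν f) := by
  rw [flow]
  split_ifs with h
  · have := add_ne_zero_of_cross (hM.isConvexAt_of_dot_pos (hν f) h).1
    rw [dot_smul_left, dot_add_left, (hν f).dot_eq, zero_add]
    exact mul_pos (inv_pos.2 (norm_pos_iff.2 this)) h
  · rw [dot_self_eq_one (hν f).norm_eq]; exact one_pos

/-- The sine of half the angle between two unit vectors. -/
lemma sq_sin_half_arccos {a b : Plane} (ha : ‖a‖ = 1) (hb : ‖b‖ = 1) :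
    Real.sin (Real.arccos (dot a b) / 2) ^ 2 = (1 - dot a b) / 2 := by
  have h := abs_dot_le a b
  rw [ha, hb, one_mul, abs_le] at h
  rw [Real.sin_sq_eq_half_sub, mul_div_cancel₀ _ two_ne_zero, Real.cos_arccos h.1 h.2]; ring

lemma sq_norm_add_unit {a b : Plane} (ha : ‖a‖ = 1) (hb : ‖b‖ = 1) :
    ‖a + b‖ ^ 2 = 2 * (1 + dot a b) := by
  rw [norm_sq_eq_dot, dot_add_left, dot_add_right, dot_add_right, dot_self_eq_one ha,
    dot_self_eq_one hb, dot_comm b]; ring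

lemma IsPolygon.iInf_interiorAngle_le (hM : IsPolygon n v M) (i : ZMod n) :
    ⨅ i, interiorAngle M v i ≤ interiorAngle M v i := by
  have := hM.isSimple.finite
  exact ciInf_le (Set.finite_range _).bddBelow i

lemma iInf_interiorAngle_nonneg (M : Set Plane) (v : ZMod n → Plane) :
    0 ≤ ⨅ i, interiorAngle M v i :=
  Real.iInf_nonneg (interiorAngle_nonneg M v)

/-- At a convex vertex of angle `φ` the value on the right is `sin φ / (2 cos (φ / 2)) = sin (φ /
2)`, and the sine is monotone up to `π / 2`. For perpendicular slices it is `1`. -/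
lemma IsPolygon.sin_le_abs_cross_flow (hM : IsPolygon n v M) (hν : ∀ f, IsInward M v f (ν f))
    (f : ZMod n × Bool) :
    Real.sin ((⨅ i, interiorAngle M v i) / 2) ≤ |cross (dir v f) (flow v ν f)| := by
  have he := hM.isSimple.norm_dir f
  have he' := hM.isSimple.norm_dir (mate f)
  rw [flow]
  split_ifs with h
  · have hc := hM.isConvexAt_of_dot_pos (hν f) h
    have h1 := hM.iInf_interiorAngle_le (idx f)
    rw [hM.interiorAngle_of_isConvexAt hc] at h1
    have h2 := iInf_interiorAngle_nonneg M v
    have h3 := Real.arccos_le_pi (dot (dir v f) (dir v (mate f)))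
    have h4 : Real.sin ((⨅ i, interiorAngle M v i) / 2) ≤
        Real.sin (Real.arccos (dot (dir v f) (dir v (mate f))) / 2) :=
      Real.sin_le_sin_of_le_of_le_pi_div_two (by linarith) (by linarith) (by linarith)
    refine h4.trans ?_
    have hN := norm_pos_iff.2 (add_ne_zero_of_cross hc.1)
    have hN2 := sq_norm_add_unit he he'
    have hS := sq_sin_half_arccos he he'
    have hk := sq_cross_add_sq_dot (dir v f) (dir v (mate f))
    rw [dot_self_eq_one he, dot_self_eq_one he'] at hk
    refine le_of_eq ?_
    have hs0 : 0 ≤ Real.sin (Real.arccos (dot (dir v f) (dir v (mate f))) / 2) :=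
      Real.sin_nonneg_of_nonneg_of_le_pi (by linarith [Real.arccos_nonneg (dot (dir v f) (dir v (mate f)))])
        (by linarith [Real.pi_pos])
    rw [← sq_eq_sq₀ hs0 (abs_nonneg _), sq_abs, cross_smul_right, cross_add_right, cross_self,
      zero_add, hS, mul_pow, inv_pow, hN2]
    have hne : (1 + dot (dir v f) (dir v (mate f))) ≠ 0 := by
      have := pow_pos hN 2
      rw [hN2] at this
      intro h0; rw [h0] at this; simp at this
    field_simp
    linarith
  · have h1 := sq_cross_add_sq_dot (dir v f) (ν f)
    rw [dot_self_eq_one he, dot_self_eq_one (hν f).norm_eq, (hν f).dot_eq] at h1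
    have h2 : |cross (dir v f) (ν f)| = 1 := by
      rw [← sq_eq_sq₀ (abs_nonneg _) zero_le_one, sq_abs]; linarith
    rw [h2]; exact Real.sin_le_one _

/-- A slice cannot end on the adjacent edge: parallel to the bisector it keeps a positive component
along `dir v f`, and a normal slice goes inward whereas the adjacent edge does not. -/
lemma IsPolygon.smul_add_flow_ne (hM : IsPolygon n v M) (hν : ∀ f, IsInward M v f (ν f))
    (f : ZMod n × Bool) {x y z : ℝ} (hx : 0 < x) (hy : 0 < y) (hz : 0 ≤ z) :
    x • dir v f + y • flow v ν f ≠ z • dir v (mate f) := by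
  intro h
  rw [flow] at h
  split_ifs at h with h0
  · have hc := (hM.isConvexAt_of_dot_pos (hν f) h0).1
    have hN := inv_pos.2 (norm_pos_iff.2 (add_ne_zero_of_cross hc))
    have h1 := congrArg (fun w => cross w (dir v (mate f))) h
    simp only [cross_add_left, cross_smul_left, cross_self, add_zero, mul_zero] at h1
    rw [← mul_assoc, ← add_mul] at h1
    have h2 := mul_pos hy hN
    rcases mul_eq_zero.1 h1 with h3 | h3
    · linarith
    · exact hc h3
  · have h1 := congrArg (fun w => dot w (ν f)) h
    simp only [dot_add_left, dot_smul_left, (hν f).dot_eq, dot_self_eq_one (hν f).norm_eq] at h1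
    have := mul_nonneg hz (neg_nonneg.2 (not_lt.1 h0))
    linarith

/-- Slices from the two edges at a vertex do not cross. At a convex vertex they stay on opposite
sides of the bisector. Otherwise a crossing forces an acute angle between the edges, hence inward
normals with nonpositive dot product, and pairing the crossing point with `ν f` gives a
contradiction. -/
lemma IsPolygon.smul_add_flow_ne_mate (hM : IsPolygon n v M) (hν : ∀ f, IsInward M v f (ν f))
    (f : ZMod n × Bool) {x y x' y' : ℝ} (hx : 0 < x) (hy : 0 < y) (hx' : 0 < x') (hy' : 0 < y') :
    x • dir v f + y • flow v ν f ≠ x' • dir v (mate f) + y' • flow v ν (mate f) := by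
  intro h
  have hiff := hM.dot_mate_pos_iff hν f
  by_cases h0 : 0 < dot (dir v (mate f)) (ν f)
  · have hc := (hM.isConvexAt_of_dot_pos (hν f) h0).1
    rw [flow, if_pos h0, flow, mate_mate, if_pos (hiff.2 h0),
      add_comm (dir v (mate f)) (dir v f)] at h
    have h1 := congrArg (fun w => cross w (dir v f + dir v (mate f))) h
    simp only [cross_add_left, cross_add_right, cross_smul_left,
      cross_self] at h1
    rw [cross_swap (dir v (mate f)) (dir v f)] at h1
    have h2 : (x + x') * cross (dir v f) (dir v (mate f)) = 0 := by linear_combination h1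
    rcases mul_eq_zero.1 h2 with h3 | h3
    · linarith
    · exact hc h3
  · have h0' : ¬ 0 < dot (dir v f) (ν (mate f)) := fun h1 => h0 (hiff.1 h1)
    rw [flow, if_neg h0, flow, mate_mate, if_neg h0'] at h
    rw [not_lt] at h0 h0'
    have he := dot_self_eq_one (hM.isSimple.norm_dir f)
    have he' := dot_self_eq_one (hM.isSimple.norm_dir (mate f))
    have hνe : ∀ g, ν g = cross (dir v g) (ν g) • perp (dir v g) := by
      intro g
      conv_lhs => rw [eq_dot_smul_add_cross_smul (hM.isSimple.norm_dir g) (ν g), dot_comm,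
        (hν g).dot_eq, zero_smul, zero_add]
    set e := dir v f
    set e' := dir v (mate f)
    set α := cross e (ν f)
    set β := cross e' (ν (mate f))
    have hp : ∀ a b : Plane, dot a (perp b) = cross b a := by
      intro a b; simp [dot, cross]; ring
    have hα : dot e' (ν f) = α * cross e e' := by
      rw [hνe f, dot_smul_right, hp]
    have hβ : dot e (ν (mate f)) = β * cross e' e := by
      rw [hνe (mate f), dot_smul_right, hp]
    have hαβ : dot (ν (mate f)) (ν f) = α * β * dot e e' := by
      rw [hνe (mate f), hνe f, dot_smul_left, dot_smul_right]
      simp [dot]; ring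
    have h1 := congrArg (fun w => dot w e) h
    have h2 := congrArg (fun w => dot w (ν f)) h
    simp only [dot_add_left, dot_smul_left] at h1 h2
    rw [dot_comm (ν f) e, dot_comm (ν (mate f)) e, (hν f).dot_eq, he, dot_comm e' e] at h1
    rw [(hν f).dot_eq, dot_self_eq_one (hν f).norm_eq, hαβ] at h2
    have hc : 0 < dot e e' := by
      have h3 : 0 < x' * dot e e' := by nlinarith [mul_nonneg hy'.le (neg_nonneg.2 h0')]
      exact (pos_iff_pos_of_mul_pos h3).1 hx'
    have hk : cross e e' ≠ 0 := by
      rcases hM.isSimple.cross_ne_zero_or f with h3 | h3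
      · exact h3
      · have h4 : e' = -e := h3
        rw [h4, ← neg_one_smul ℝ, dot_smul_right, he] at hc
        linarith
    have hk2 : 0 < cross e e' * cross e e' := mul_self_pos.2 hk
    have hab : α * β ≤ 0 := by
      rw [hα] at h0
      rw [hβ, cross_swap] at h0'
      have h3 : (α * β) * (cross e e' * cross e e') ≤ 0 := by
        nlinarith [mul_nonneg (neg_nonneg.2 h0) (neg_nonneg.2 h0')]
      exact nonpos_of_mul_nonpos_left h3 hk2
    have h5 : α * β * dot e e' ≤ 0 := mul_nonpos_of_nonpos_of_nonneg hab hc.le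
    nlinarith [mul_nonneg hy'.le (neg_nonneg.2 h5), mul_nonneg hx'.le (neg_nonneg.2 h0)]

variable {Ω : Set Plane}

/-! ### The isoperimetric inequality for sets of small perimeter -/

/-- By compactness: the first two thirds of an edge are disjoint from every edge that does not
contain its initial vertex. The cutting lines will be placed in the middle third, so two thirds
suffice. -/
lemma IsPolygon.exists_separation (hM : IsPolygon n v M) :
    ∀ᶠ d : ℝ in 𝓝[>] 0, ∀ (f : ZMod n × Bool) (j : ZMod n), j ≠ f.1 → j ≠ (mate f).1 →
      ∀ x, 0 ≤ x → x ≤ 2 / 3 * len v f → ∀ q ∈ edge v j,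
        d < dist (tail v f + x • dir v f) q := by
  have := hM.isSimple.finite
  rw [eventually_all]
  intro f
  rw [eventually_all]
  intro j
  by_cases hj : j ≠ f.1 ∧ j ≠ (mate f).1
  · set S : Set Plane := (fun x : ℝ => tail v f + x • dir v f) '' Icc 0 (2 / 3 * len v f)
    have hS : IsCompact S := isCompact_Icc.image (by fun_prop)
    have hd : Disjoint S (edge v j) := by
      rw [Set.disjoint_left]
      rintro _ ⟨x, hx, rfl⟩ hq
      have hl := hM.isSimple.len_pos f
      rcases hM.isSimple.eq_or_mate f hx.1 (by linarith [hx.2]) hq with h | h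
      · exact hj.1 h
      · exact hj.2 h.1
    obtain ⟨r, hr, h⟩ := Metric.exists_pos_forall_lt_edist hS (isCompact_edge j).isClosed hd
    filter_upwards [Ioo_mem_nhdsGT (NNReal.coe_pos.2 hr)] with d hd _ _ x hx0 hx q hq
    have h1 := h _ (mem_image_of_mem _ ⟨hx0, hx⟩) q hq
    rw [edist_dist, ← ENNReal.ofReal_coe_nnreal, ENNReal.ofReal_lt_ofReal_iff'] at h1
    exact hd.2.trans h1.1
  · exact Eventually.of_forall fun d h1 h2 => absurd ⟨h1, h2⟩ hj

/-- The region swept out by the slicing segments of length at most `h` that start from points at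
distance less than `m` from the vertex of a flag. -/
def sweep (v : ZMod n → Plane) (ν : ZMod n × Bool → Plane) (f : ZMod n × Bool) (m h : ℝ) :
    Set Plane :=
  {q | 0 < cross (q - tail v f) (flow v ν f) / cross (dir v f) (flow v ν f) ∧
    cross (q - tail v f) (flow v ν f) / cross (dir v f) (flow v ν f) ≤ 2 / 3 * len v f ∧
    0 < cross (dir v f) (q - tail v f) / cross (dir v f) (flow v ν f) ∧
    cross (dir v f) (q - tail v f) / cross (dir v f) (flow v ν f) ≤ h ∧
    dot (q - tail v f) (dir v f) < m}

lemma measurableSet_sweep (f : ZMod n × Bool) (m h : ℝ) : MeasurableSet (sweep v ν f m h) := by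
  have h1 : Continuous fun q : Plane =>
      cross (q - tail v f) (flow v ν f) / cross (dir v f) (flow v ν f) :=
    ((continuous_cross_left _).comp (by fun_prop)).div_const _
  have h2 : Continuous fun q : Plane =>
      cross (dir v f) (q - tail v f) / cross (dir v f) (flow v ν f) :=
    ((continuous_cross_right _).comp (by fun_prop)).div_const _
  have h3 : Continuous fun q : Plane => dot (q - tail v f) (dir v f) :=
    (continuous_dot_left _).comp (by fun_prop)
  exact (isOpen_lt continuous_const h1).measurableSet.inter
    ((isClosed_le h1 continuous_const).measurableSet.inter
    ((isOpen_lt continuous_const h2).measurableSet.inter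
    ((isClosed_le h2 continuous_const).measurableSet.inter
    (isOpen_lt h3 continuous_const).measurableSet)))

lemma IsPolygon.cross_flow_ne_zero (hM : IsPolygon n v M) (hν : ∀ f, IsInward M v f (ν f))
    (f : ZMod n × Bool) : cross (dir v f) (flow v ν f) ≠ 0 := by
  intro h
  have h1 := eq_smul_of_cross_eq_zero (hM.isSimple.norm_dir f) (a := flow v ν f)
    (by rw [cross_swap, h, neg_zero])
  have h2 := hM.dot_flow_pos hν f
  rw [h1, dot_smul_left, (hν f).dot_eq, mul_zero] at h2
  exact lt_irrefl _ h2

lemma IsPolygon.mem_sweep_iff (hM : IsPolygon n v M) (hν : ∀ f, IsInward M v f (ν f))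
    (f : ZMod n × Bool) {m h : ℝ} {q : Plane} :
    q ∈ sweep v ν f m h ↔ ∃ x y : ℝ, 0 < x ∧ x ≤ 2 / 3 * len v f ∧ 0 < y ∧ y ≤ h ∧
      q = tail v f + x • dir v f + y • flow v ν f ∧ dot (q - tail v f) (dir v f) < m := by
  have hk := hM.cross_flow_ne_zero hν f
  constructor
  · rintro ⟨h1, h2, h3, h4, h5⟩
    refine ⟨_, _, h1, h2, h3, h4, ?_, h5⟩
    have hdec := cross_smul_eq (dir v f) (flow v ν f) (q - tail v f)
    rw [add_assoc, div_eq_inv_mul, div_eq_inv_mul, mul_smul, mul_smul, ← smul_add, ← hdec,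
      smul_smul, inv_mul_cancel₀ hk, one_smul]
    abel
  · rintro ⟨x, y, h1, h2, h3, h4, rfl, h5⟩
    have e1 : cross (tail v f + x • dir v f + y • flow v ν f - tail v f) (flow v ν f) /
        cross (dir v f) (flow v ν f) = x := by
      rw [div_eq_iff hk, add_assoc, add_sub_cancel_left, cross_add_left, cross_smul_left,
        cross_smul_left, cross_self]; ring
    have e2 : cross (dir v f) (tail v f + x • dir v f + y • flow v ν f - tail v f) /
        cross (dir v f) (flow v ν f) = y := by
      rw [div_eq_iff hk, add_assoc, add_sub_cancel_left, cross_add_right, cross_smul_right,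
        cross_smul_right, cross_self]; ring
    refine ⟨?_, ?_, ?_, ?_, h5⟩
    · rwa [e1]
    · rwa [e1]
    · rwa [e2]
    · rwa [e2]

/-- The roles have to be exchanged when `g` lies on the edge of `mate f` but starts at its far end.
Then the edges at the start of `g` do not include that of `f`, because `2 ≠ 0` in `ZMod n`. -/
lemma IsSimpleClosedPolygonalCurve.flag_cases (hv : IsSimpleClosedPolygonalCurve n v)
    {f g : ZMod n × Bool} (h1 : g ≠ f) (h2 : g ≠ mate f) (h3 : g ≠ opp f) :
    (g.1 ≠ f.1 ∧ g.1 ≠ (mate f).1) ∨ (f.1 ≠ g.1 ∧ f.1 ≠ (mate g).1) := by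
  have hone := hv.one_ne_zero
  have htwo := hv.two_ne_zero
  by_cases h4 : g.1 = f.1
  · exfalso
    obtain ⟨i, b⟩ := f
    obtain ⟨j, c⟩ := g
    obtain rfl : j = i := h4
    cases b <;> cases c <;> simp [opp] at h1 h3
  by_cases h5 : g.1 = (mate f).1
  · right
    refine ⟨fun h => h4 h.symm, ?_⟩
    obtain ⟨i, b⟩ := f
    obtain ⟨j, c⟩ := g
    have h2' : ∀ i : ZMod n, i ≠ i + 1 + 1 := by
      intro i h; apply htwo
      have : i + 1 + 1 = i + 2 := by ring
      rw [this] at h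
      simpa using h.symm
    have h3' : ∀ i : ZMod n, i ≠ i - 1 - 1 := by
      intro i h; apply h2' (i - 1 - 1)
      have h6 : i - 1 - 1 + 1 + 1 = i := by ring
      rw [h6]; exact h.symm
    cases b <;> cases c <;> simp only [mate, cond_true, cond_false, ne_eq] at h2 h5 ⊢ <;> subst h5
    · exact h2' i
    · exact absurd rfl h2
    · exact absurd rfl h2
    · exact h3' i
  · exact Or.inl ⟨h4, h5⟩

/-- The sweeps of different flags are disjoint. -/
lemma IsPolygon.disjoint_sweep (hM : IsPolygon n v M) (hν : ∀ f, IsInward M v f (ν f))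
    {m : ZMod n × Bool → ℝ} (hm : ∀ f, m f + m (opp f) = len v f) {h : ℝ}
    (hd : ∀ (f : ZMod n × Bool) (j : ZMod n), j ≠ f.1 → j ≠ (mate f).1 →
      ∀ x, 0 ≤ x → x ≤ 2 / 3 * len v f → ∀ q ∈ edge v j,
        2 * h < dist (tail v f + x • dir v f) q) {f g : ZMod n × Bool} (hfg : f ≠ g) :
    Disjoint (sweep v ν f (m f) h) (sweep v ν g (m g) h) := by
  rw [Set.disjoint_left]
  intro q hqf hqg
  obtain ⟨x, y, hx, hxl, hy, hyh, hq, hlt⟩ := (hM.mem_sweep_iff hν f).1 hqf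
  obtain ⟨x', y', hx', hxl', hy', hyh', hq', hlt'⟩ := (hM.mem_sweep_iff hν g).1 hqg
  by_cases h2 : g = mate f
  · subst h2
    refine hM.smul_add_flow_ne_mate hν f hx hy hx' hy' ?_
    rw [hq, tail_mate, add_assoc, add_assoc] at hq'
    exact add_left_cancel hq'
  -- Sweeps from the two ends of one edge are separated by the perpendicular line at distance `m f`
  -- from `tail v f`.
  by_cases h3 : g = opp f
  · subst h3
    have h4 : q - head v f = (q - tail v f) - len v f • dir v f := by
      rw [hM.isSimple.len_smul_dir]; abel
    have h5 := dot_self_eq_one (hM.isSimple.norm_dir f)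
    rw [tail_opp, dir_opp, h4, ← neg_one_smul ℝ, dot_smul_right, dot_sub_left, dot_smul_left,
      h5] at hlt'
    have := hm f
    linarith
  have hdist : ∀ (g : ZMod n × Bool) (x y : ℝ), 0 < y → y ≤ h →
      q = tail v g + x • dir v g + y • flow v ν g → dist (tail v g + x • dir v g) q ≤ h := by
    intro g x y h1 h2 h3
    rw [dist_eq_norm, h3, sub_add_cancel_left, norm_neg, norm_smul, hM.norm_flow hν g, mul_one,
      Real.norm_of_nonneg h1.le]
    exact h2
  have h6 := hdist f x y hy hyh hq
  have h7 := hdist g x' y' hy' hyh' hq'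
  have hmem : ∀ (g : ZMod n × Bool) (x : ℝ), 0 < x → x ≤ 2 / 3 * len v g →
      tail v g + x • dir v g ∈ edge v g.1 := fun g x h1 h2 =>
    (hM.isSimple.mem_edge_iff g).2 ⟨x, ⟨h1.le, by linarith [hM.isSimple.len_pos g]⟩, rfl⟩
  -- For all other pairs, both base points are within `h` of `q`, while one of them is farther than
  -- `2 * h` from the edge of the other.
  have htri := dist_triangle_right (tail v f + x • dir v f) (tail v g + x' • dir v g) q
  rcases hM.isSimple.flag_cases hfg.symm h2 h3 with ⟨h8, h9⟩ | ⟨h8, h9⟩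
  · have := hd f g.1 h8 h9 x hx.le hxl _ (hmem g x' hx' hxl')
    linarith
  · have := hd g f.1 h8 h9 x' hx'.le hxl' _ (hmem f x hx hxl)
    rw [dist_comm] at this
    linarith

/-! ### Slicing an admissible set -/

lemma IsPolygon.isBounded_of_mem_admissible (hM : IsPolygon n v M) (hΩ : Ω ∈ admissible M) :
    Bornology.IsBounded Ω := hM.isBounded.subset hΩ.1

/-- At all but finitely many points of its exterior boundary, an admissible set contains short
segments in all inward directions. -/
lemma exists_finite_eventually_mem_of_admissible
    (hν : ∀ f, IsInward M v f (ν f)) (hΩ : Ω ∈ admissible M) :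
    ∃ F : Set Plane, F.Finite ∧ ∀ (f : ZMod n × Bool) (x : ℝ), x ∈ Ioo 0 (len v f) →
      tail v f + x • dir v f ∈ frontier Ω → tail v f + x • dir v f ∉ F →
      ∀ u : Plane, ‖u‖ = 1 → 0 < dot u (ν f) →
        ∀ᶠ t : ℝ in 𝓝[>] 0, tail v f + x • dir v f + t • u ∈ Ω := by
  obtain ⟨F, hF, h⟩ := Escobar.exists_finite_eventually_mem hΩ.2.2.1 hΩ.2.2.2
  refine ⟨F, hF, fun f x hx hp hpF u hu huν => h _ hp hpF (ν f) u hu huν ?_⟩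
  obtain ⟨r, hr, hs⟩ := (hν f).side x hx
  filter_upwards [Metric.ball_mem_nhds _ hr] with q hq hqΩ
  exact (hs q hq).2 (subset_closure (hΩ.1 hqΩ))

/-- The point is the first exit from `Ω` of the slice starting at abscissa `x`. The final equation
records that projection along the slice recovers `x`, up to the factor used in the length estimate.
-/
lemma IsPolygon.exists_mem_sweep (hM : IsPolygon n v M) (hν : ∀ f, IsInward M v f (ν f))
    (hΩ : Ω ∈ admissible M) {h : ℝ} (hh : length (frontier Ω) ≤ ENNReal.ofReal h) (h0 : 0 ≤ h)
    (hd : ∀ (f : ZMod n × Bool) (j : ZMod n), j ≠ f.1 → j ≠ (mate f).1 →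
      ∀ x, 0 ≤ x → x ≤ 2 / 3 * len v f → ∀ q ∈ edge v j,
        2 * h < dist (tail v f + x • dir v f) q)
    (f : ZMod n × Bool) {m : ℝ} (hm : m < 2 / 3 * len v f)
    (hline : ∀ q ∈ frontier Ω, dot (q - tail v f) (dir v f) ≠ m) {x : ℝ} (hx : 0 < x) (hxm : x < m)
    (hev : ∀ᶠ t : ℝ in 𝓝[>] 0, tail v f + x • dir v f + t • flow v ν f ∈ Ω) :
    ∃ q ∈ frontier Ω ∩ M ∩ sweep v ν f m h,
      cross (q - tail v f) (flow v ν f) = cross (dir v f) (flow v ν f) * x := by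
  have hu := hM.norm_flow hν f
  have hu0 : flow v ν f ≠ 0 := by rw [← norm_pos_iff, hu]; exact one_pos
  have hΩb := hM.isBounded_of_mem_admissible hΩ
  have hΩo := hΩ.2.2.1
  obtain ⟨T, hT, hin, hex⟩ := exists_exit hΩo hΩb hu0 hev
  have hTh : T ≤ h := by
    have := (ofReal_le_length_frontier hΩo hΩb hu hin).trans hh
    rwa [ENNReal.ofReal_le_ofReal_iff h0] at this
  have hlen := hM.isSimple.len_pos f
  set p := tail v f + x • dir v f with hp
  set u := flow v ν f with hudef
  have hdotp : ∀ t : ℝ, dot (p + t • u - tail v f) (dir v f) = x + t * dot u (dir v f) := by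
    intro t
    rw [hp, add_assoc, add_sub_cancel_left, dot_add_left, dot_smul_left, dot_smul_left,
      dot_self_eq_one (hM.isSimple.norm_dir f), mul_one]
  -- To pass the cutting line, the slice would have to meet it in `Ω` or on its frontier. The line
  -- misses the frontier, hence also the bounded set `Ω`.
  have hlt : dot (p + T • u - tail v f) (dir v f) < m := by
    by_contra hge
    rw [not_lt, hdotp] at hge
    have hc : ContinuousOn (fun t : ℝ => x + t * dot u (dir v f)) (Icc 0 T) := by fun_prop
    obtain ⟨t, ht, hte⟩ := intermediate_value_Icc hT.le hc
      (show m ∈ Icc (x + 0 * dot u (dir v f)) (x + T * dot u (dir v f)) from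
        ⟨by linarith, hge⟩)
    simp only at hte
    rw [← hdotp] at hte
    rcases ht.1.eq_or_lt with h1 | h1
    · rw [← h1, hdotp] at hte; linarith
    rcases ht.2.eq_or_lt with h2 | h2
    · rw [h2] at hte; exact hline _ hex hte
    · exact not_mem_of_line hΩo hΩb (hM.isSimple.norm_dir f) hline _ (hin t ⟨h1, h2⟩) hte
  -- The exit point is on no edge: the slice is transversal to its own edge, avoids the adjacent one
  -- by `IsPolygon.smul_add_flow_ne`, and is too short to reach the others.
  have hM' : p + T • u ∈ M := by
    refine hM.mem_of_mem_closure (closure_mono hΩ.1 (frontier_subset_closure hex)) fun hfr => ?_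
    obtain ⟨j, hj⟩ := hM.mem_frontier_iff.1 hfr
    by_cases h1 : j = f.1
    · subst h1
      obtain ⟨z, -, hz⟩ := (hM.isSimple.mem_edge_iff f).1 hj
      rw [hp, add_assoc] at hz
      have h2 := congrArg (fun w => cross (dir v f) w) (add_left_cancel hz)
      simp only [cross_add_right, cross_smul_right, cross_self, mul_zero, zero_add] at h2
      exact (mul_ne_zero hT.ne' (hM.cross_flow_ne_zero hν f)) h2
    by_cases h2 : j = (mate f).1
    · subst h2
      obtain ⟨z, hz0, hz⟩ := (hM.isSimple.mem_edge_iff (mate f)).1 hj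
      rw [hp, add_assoc, tail_mate] at hz
      exact hM.smul_add_flow_ne hν f hx hT hz0.1 (add_left_cancel hz)
    · have h3 := hd f j h1 h2 x hx.le (by linarith) _ hj
      rw [← hp, dist_eq_norm, sub_add_cancel_left, norm_neg, norm_smul, hu, mul_one,
        Real.norm_of_nonneg hT.le] at h3
      linarith
  refine ⟨p + T • u, ⟨⟨hex, hM'⟩, (hM.mem_sweep_iff hν f).2
    ⟨x, T, hx, by linarith, hT, hTh, rfl, hlt⟩⟩, ?_⟩
  rw [hp, add_assoc, add_sub_cancel_left, cross_add_left, cross_smul_left, cross_smul_left,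
    cross_self]; ring

/-- The projection of `Γ` to the line has measure at most `h`, too little to cover the interval. -/
lemma exists_barrier {Γ : Set Plane} {h : ℝ} (hh : length Γ ≤ ENNReal.ofReal h) {p e : Plane}
    (he : ‖e‖ = 1) {a b : ℝ} (hab : h < b - a) (hlt : a < b) :
    ∃ m ∈ Ioo a b, ∀ q ∈ Γ, dot (q - p) e ≠ m := by
  by_contra hno
  push Not at hno
  have h1 := (volume_le_length (lipschitzWith_dot he p) hno).trans hh
  rw [Real.volume_Ioo, ENNReal.ofReal_le_ofReal_iff'] at h1
  rcases h1 with h1 | h1 <;> linarith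

open scoped Pointwise in
lemma IsPolygon.mul_length_halfEdge_le (hM : IsPolygon n v M) (hν : ∀ f, IsInward M v f (ν f))
    (hΩ : Ω ∈ admissible M) {h : ℝ} (hh : length (frontier Ω) ≤ ENNReal.ofReal h) (h0 : 0 ≤ h)
    (hd : ∀ (f : ZMod n × Bool) (j : ZMod n), j ≠ f.1 → j ≠ (mate f).1 →
      ∀ x, 0 ≤ x → x ≤ 2 / 3 * len v f → ∀ q ∈ edge v j,
        2 * h < dist (tail v f + x • dir v f) q)
    (f : ZMod n × Bool) {m : ℝ} (hm : m < 2 / 3 * len v f)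
    (hline : ∀ q ∈ frontier Ω, dot (q - tail v f) (dir v f) ≠ m) :
    ENNReal.ofReal (Real.sin ((⨅ i, interiorAngle M v i) / 2)) *
      length (frontier Ω ∩ (fun x : ℝ => tail v f + x • dir v f) '' Ioo 0 m) ≤
      length (frontier Ω ∩ M ∩ sweep v ν f m h) := by
  obtain ⟨F, hF, hFev⟩ := exists_finite_eventually_mem_of_admissible hν hΩ
  have hlen := hM.isSimple.len_pos f
  set k := cross (dir v f) (flow v ν f) with hk
  set A : Set ℝ := {x | x ∈ Ioo 0 m ∧ tail v f + x • dir v f ∈ frontier Ω ∧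
    tail v f + x • dir v f ∉ F} with hA
  have h1 : length (frontier Ω ∩ (fun x : ℝ => tail v f + x • dir v f) '' Ioo 0 m) ≤ volume A := by
    calc _ ≤ length ((fun x : ℝ => tail v f + x • dir v f) '' A ∪ F) := by
            refine length_mono ?_
            rintro _ ⟨hq, x, hx, rfl⟩
            by_cases hqF : tail v f + x • dir v f ∈ F
            · exact Or.inr hqF
            · exact Or.inl ⟨x, ⟨hx, hq, hqF⟩, rfl⟩
      _ ≤ length ((fun x : ℝ => tail v f + x • dir v f) '' A) + length F := measure_union_le _ _
      _ ≤ volume A + 0 := add_le_add (length_image_line_le (hM.isSimple.norm_dir f) _ _)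
            (length_finite hF).le
      _ = volume A := add_zero _
  -- Projection along the slices sends the exit points onto `k • A`, so their length is at least
  -- `|k|` times the measure of `A`.
  have h2 : ENNReal.ofReal |k| * volume A ≤ length (frontier Ω ∩ M ∩ sweep v ν f m h) := by
    have h3 : ENNReal.ofReal |k| * volume A = volume (k • A) := by
      rw [Measure.addHaar_smul]; simp
    rw [h3]
    refine volume_le_length (lipschitzWith_cross (hM.norm_flow hν f) (tail v f)) ?_
    rintro _ ⟨x, ⟨hx, hxΓ, hxF⟩, rfl⟩
    have hxl : x ∈ Ioo 0 (len v f) := ⟨hx.1, by linarith [hx.2]⟩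
    exact hM.exists_mem_sweep hν hΩ hh h0 hd f hm hline hx.1 hx.2
      (hFev f x hxl hxΓ hxF _ (hM.norm_flow hν f) (hM.dot_flow_pos hν f))
  exact (mul_le_mul' (ENNReal.ofReal_le_ofReal (hM.sin_le_abs_cross_flow hν f)) h1).trans h2

/-- The isoperimetric inequality for admissible sets of small perimeter. -/
lemma IsPolygon.exists_isoperimetric (hM : IsPolygon n v M) : ∃ h : ℝ, 0 < h ∧
    ∀ Ω ∈ admissible M, length (frontier Ω) ≤ ENNReal.ofReal h →
      ENNReal.ofReal (Real.sin ((⨅ i, interiorAngle M v i) / 2)) * length (exteriorBoundary M Ω) ≤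
        length (interiorBoundary M Ω) := by
  have hfin := hM.isSimple.finite
  have : Fintype (ZMod n) := Fintype.ofFinite _
  choose ν hν using hM.exists_isInward
  have hlen3 : ∀ᶠ h : ℝ in 𝓝[>] 0, ∀ i : ZMod n, h < len v (i, true) / 3 := by
    rw [eventually_all]
    intro i
    have := hM.isSimple.len_pos (i, true)
    filter_upwards [Ioo_mem_nhdsGT (show 0 < len v (i, true) / 3 by linarith)] with h hh
    exact hh.2
  obtain ⟨d, ⟨hsep, hd3⟩, hd0⟩ := ((hM.exists_separation.and hlen3).and
    self_mem_nhdsWithin).exists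
  have hd0 : 0 < d := hd0
  refine ⟨d / 2, half_pos hd0, fun Ω hΩ hh => ?_⟩
  have hd : ∀ (f : ZMod n × Bool) (j : ZMod n), j ≠ f.1 → j ≠ (mate f).1 →
      ∀ x, 0 ≤ x → x ≤ 2 / 3 * len v f → ∀ q ∈ edge v j,
        2 * (d / 2) < dist (tail v f + x • dir v f) q := by
    rw [mul_div_cancel₀ _ two_ne_zero]; exact hsep
  have hbar : ∀ i : ZMod n, ∃ m ∈ Ioo (1 / 3 * len v (i, true)) (2 / 3 * len v (i, true)),
      ∀ q ∈ frontier Ω, dot (q - tail v (i, true)) (dir v (i, true)) ≠ m := by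
    intro i
    have h1 := hM.isSimple.len_pos (i, true)
    have h2 := hd3 i
    exact exists_barrier hh (hM.isSimple.norm_dir _) (by linarith) (by linarith)
  choose μ hμ hμΓ using hbar
  -- Both flags of an edge use the same cutting line, each measuring its position from its own end;
  -- lying in the middle third, it is within two thirds of either end.
  set m : ZMod n × Bool → ℝ := fun f => cond f.2 (μ f.1) (len v f - μ f.1) with hmdef
  have hlenft : ∀ i, len v (i, false) = len v (i, true) := fun i => len_opp v (i, true)
  have hdirft : ∀ i, dir v (i, false) = -dir v (i, true) := fun i => dir_opp v (i, true)
  have htailft : ∀ i, tail v (i, false) = tail v (i, true) + len v (i, true) • dir v (i, true) := by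
    intro i; rw [hM.isSimple.len_smul_dir]; simp [tail, head]
  have hmopp : ∀ f, m f + m (opp f) = len v f := by
    rintro ⟨i, _ | _⟩ <;> simp [hmdef, opp, hlenft]
  have hm23 : ∀ f, m f < 2 / 3 * len v f := by
    rintro ⟨i, _ | _⟩ <;> simp only [hmdef, cond_true, cond_false, hlenft]
    · linarith [(hμ i).1]
    · exact (hμ i).2
  have hline : ∀ f, ∀ q ∈ frontier Ω, dot (q - tail v f) (dir v f) ≠ m f := by
    rintro ⟨i, _ | _⟩ q hq
    · simp only [hmdef, cond_false]
      intro h1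
      refine hμΓ i q hq ?_
      rw [htailft, hdirft, hlenft, ← neg_one_smul ℝ, dot_smul_right, ← sub_sub, dot_sub_left,
        dot_smul_left, dot_self_eq_one (hM.isSimple.norm_dir _)] at h1
      linarith
    · exact hμΓ i q hq
  set G : ZMod n × Bool → Set Plane := fun f =>
    frontier Ω ∩ (fun x : ℝ => tail v f + x • dir v f) '' Ioo 0 (m f) with hG
  -- Only the vertices and the feet of the cutting lines are outside the open half-edges. The feet
  -- are not in `∂Ω`, and the vertices have length zero.
  have hcover : exteriorBoundary M Ω ⊆ (⋃ f, G f) ∪ range v := by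
    rintro p ⟨hpΓ, hpJ⟩
    obtain ⟨i, hi⟩ := hM.mem_frontier_iff.1 hpJ
    obtain ⟨x, hx, hpx⟩ := (hM.isSimple.mem_edge_iff (i, true)).1 hi
    rcases hx.1.eq_or_lt with h1 | h1
    · exact Or.inr ⟨i, by rw [hpx, ← h1]; simp [tail]⟩
    rcases hx.2.eq_or_lt with h2 | h2
    · exact Or.inr ⟨i + 1, by rw [hpx, h2, ← htailft]; simp [tail]⟩
    left
    rw [mem_iUnion]
    have h3 : x ≠ μ i := by
      have := hμΓ i p hpΓ
      rwa [hpx, add_sub_cancel_left, dot_smul_left, dot_self_eq_one (hM.isSimple.norm_dir _),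
        mul_one] at this
    rcases lt_or_gt_of_ne h3 with h4 | h4
    · exact ⟨(i, true), hpΓ, x, ⟨h1, h4⟩, hpx.symm⟩
    · refine ⟨(i, false), hpΓ, len v (i, true) - x, ⟨by linarith, ?_⟩, ?_⟩
      · simp only [hmdef, cond_false, hlenft]; linarith
      · simp only
        rw [htailft, hdirft, hpx, smul_neg, sub_smul]; abel
  set s := ENNReal.ofReal (Real.sin ((⨅ i, interiorAngle M v i) / 2))
  have hmeas : ∀ f, MeasurableSet (frontier Ω ∩ M ∩ sweep v ν f (m f) (d / 2)) := fun f =>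
    (isClosed_frontier.measurableSet.inter hM.isOpen.measurableSet).inter (measurableSet_sweep _ _ _)
  calc s * length (exteriorBoundary M Ω)
      ≤ s * length ((⋃ f, G f) ∪ range v) := by gcongr; exact length_mono hcover
    _ ≤ s * (length (⋃ f, G f) + length (range v)) := by gcongr; exact measure_union_le _ _
    _ = s * length (⋃ f, G f) := by rw [length_finite (finite_range v), add_zero]
    _ ≤ s * ∑ f, length (G f) := by gcongr; exact measure_iUnion_fintype_le _ _
    _ = ∑ f, s * length (G f) := Finset.mul_sum _ _ _
    _ ≤ ∑ f, length (frontier Ω ∩ M ∩ sweep v ν f (m f) (d / 2)) := by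
        refine Finset.sum_le_sum fun f _ => ?_
        exact hM.mul_length_halfEdge_le hν hΩ hh (half_pos hd0).le hd f (hm23 f) (hline f)
    _ = length (⋃ f, frontier Ω ∩ M ∩ sweep v ν f (m f) (d / 2)) := by
        refine ((measure_iUnion (μ := Measure.hausdorffMeasure 1) (fun f g hfg => ?_) hmeas).trans
          (tsum_fintype _)).symm
        exact (hM.disjoint_sweep hν hmopp hd hfg).mono inter_subset_right inter_subset_right
    _ ≤ length (interiorBoundary M Ω) :=
        length_mono (iUnion_subset fun f => inter_subset_left)

/-! ### From small perimeter to large `k` -/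

lemma length_frontier_pos (hM : IsPolygon n v M) (hΩ : Ω ∈ admissible M) :
    length (frontier Ω) ≠ 0 := by
  obtain ⟨p, hp⟩ := hΩ.2.1
  obtain ⟨r, hr, hs⟩ := Metric.isOpen_iff.1 hΩ.2.2.1 p hp
  set u : Plane := !₂[1, 0]
  have hu : ‖u‖ = 1 := norm_eq_one_of_dot (by simp [u, dot])
  have h1 := ofReal_le_length_frontier hΩ.2.2.1 (hM.isBounded_of_mem_admissible hΩ) (p := p) hu (T := r)
    fun t ht => hs (by
      rw [Metric.mem_ball, dist_eq_norm, add_sub_cancel_left, norm_smul, hu, mul_one,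
        Real.norm_of_nonneg ht.1.le]
      exact ht.2)
  exact ((ENNReal.ofReal_pos.2 hr).trans_le h1).ne'

lemma length_frontier_le (hΩ : Ω ∈ admissible M) :
    length (frontier Ω) ≤ length (interiorBoundary M Ω) + length (exteriorBoundary M Ω) := by
  refine (length_mono ?_).trans (measure_union_le _ _)
  intro q hq
  by_cases h : q ∈ M
  · exact Or.inl ⟨hq, h⟩
  · refine Or.inr ⟨hq, closure_mono hΩ.1 (frontier_subset_closure hq), fun h1 => h ?_⟩
    exact interior_subset h1

lemma IsPolygon.exists_le_isoperimetricRatio (hM : IsPolygon n v M) : ∃ h : ℝ, 0 < h ∧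
    ∀ Ω ∈ admissible M, length (exteriorBoundary M Ω) ≤ ENNReal.ofReal h →
      ENNReal.ofReal (Real.sin ((⨅ i, interiorAngle M v i) / 2)) ≤ isoperimetricRatio M Ω := by
  obtain ⟨h, hh, hiso⟩ := hM.exists_isoperimetric
  refine ⟨h / 2, half_pos hh, fun Ω hΩ hext => ?_⟩
  rw [isoperimetricRatio]
  split_ifs with h0
  · exact le_top
  have hle := length_frontier_le hΩ
  have hpos := length_frontier_pos hM hΩ
  rw [ENNReal.le_div_iff_mul_le]
  · rcases le_total (length (interiorBoundary M Ω)) (length (exteriorBoundary M Ω)) with h1 | h1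
    · refine hiso Ω hΩ (hle.trans ?_)
      calc _ ≤ ENNReal.ofReal (h / 2) + ENNReal.ofReal (h / 2) := add_le_add (h1.trans hext) hext
        _ = ENNReal.ofReal h := by
          rw [← ENNReal.ofReal_add (half_pos hh).le (half_pos hh).le, add_halves]
    · refine le_trans ?_ h1
      exact mul_le_of_le_one_left' (ENNReal.ofReal_le_one.2 (Real.sin_le_one _))
  -- The quotient `0 / 0`, which is `0` in `ℝ≥0∞`, has to be excluded; it would require a frontier
  -- of length zero.
  · by_contra hno
    push Not at hno
    rw [hno.1, hno.2, add_zero] at hle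
    exact hpos (le_antisymm hle bot_le)
  · exact Or.inl (ne_top_of_le_ne_top ENNReal.ofReal_ne_top hext)

/-- Away from finitely many points, a common boundary point would be the start of an inward normal
segment contained in both disjoint sets. -/
lemma IsPolygon.length_inter_exteriorBoundary (hM : IsPolygon n v M) {Ω₁ Ω₂ : Set Plane}
    (h₁ : Ω₁ ∈ admissible M) (h₂ : Ω₂ ∈ admissible M) (hd : Disjoint Ω₁ Ω₂) :
    length (exteriorBoundary M Ω₁ ∩ exteriorBoundary M Ω₂) = 0 := by
  have hfin := hM.isSimple.finite
  choose ν hν using hM.exists_isInward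
  obtain ⟨F₁, hF₁, hev₁⟩ := exists_finite_eventually_mem_of_admissible hν h₁
  obtain ⟨F₂, hF₂, hev₂⟩ := exists_finite_eventually_mem_of_admissible hν h₂
  refine length_finite (((hF₁.union hF₂).union (finite_range v)).subset ?_)
  rintro p ⟨⟨hp1, hpJ⟩, hp2, -⟩
  by_contra hno
  simp only [mem_union, mem_range, not_or, not_exists] at hno
  obtain ⟨i, hi⟩ := hM.mem_frontier_iff.1 hpJ
  obtain ⟨x, hx, rfl⟩ := (hM.isSimple.mem_edge_iff (i, true)).1 hi
  have hx0 : 0 < x := by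
    refine lt_of_le_of_ne hx.1 fun h => hno.2 i ?_
    rw [← h]; simp [tail]
  have hx1 : x < len v (i, true) := by
    refine lt_of_le_of_ne hx.2 fun h => hno.2 (i + 1) ?_
    rw [h, hM.isSimple.len_smul_dir]; simp [tail, head]
  have hn := (hν (i, true)).norm_eq
  have hdot : 0 < dot (ν (i, true)) (ν (i, true)) := by rw [dot_self_eq_one hn]; exact one_pos
  obtain ⟨t, ht1, ht2⟩ := ((hev₁ _ x ⟨hx0, hx1⟩ hp1 hno.1.1 _ hn hdot).and
    (hev₂ _ x ⟨hx0, hx1⟩ hp2 hno.1.2 _ hn hdot)).exists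
  exact Set.disjoint_left.1 hd ht1 ht2

lemma IsPolygon.length_frontier_ne_top (hM : IsPolygon n v M) : length (frontier M) ≠ ⊤ := by
  have hfin := hM.isSimple.finite
  have : Fintype (ZMod n) := Fintype.ofFinite _
  rw [hM.frontier_eq]
  refine ne_top_of_le_ne_top ?_ (measure_iUnion_fintype_le _ _)
  rw [ENNReal.sum_ne_top]
  intro i _
  have := length_segment (v i) (v (i + 1))
  rw [length] at this
  rw [edge, this]
  exact edist_ne_top _ _

/-- The lower bound for the Escobar constants of high order. -/
theorem IsPolygon.exists_le_escobarConstant (hM : IsPolygon n v M) : ∃ n₀ : ℕ, ∀ k : ℕ, n₀ ≤ k →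
    ENNReal.ofReal (Real.sin ((⨅ i, interiorAngle M v i) / 2)) ≤ escobarConstant M k := by
  obtain ⟨h, hh, hratio⟩ := hM.exists_le_isoperimetricRatio
  obtain ⟨n₀, hn₀⟩ := ENNReal.exists_nat_mul_gt (ENNReal.ofReal_pos.2 hh).ne'
    hM.length_frontier_ne_top
  refine ⟨n₀, fun k hk => le_iInf₂ fun Ω hΩ => ?_⟩
  -- Pigeonhole: otherwise `k ≥ n₀` almost disjoint pieces of `∂M`, each longer than `h`, would
  -- exceed the length of `∂M`.
  obtain ⟨j, hj⟩ : ∃ j, length (exteriorBoundary M (Ω j)) ≤ ENNReal.ofReal h := by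
    by_contra hno
    push Not at hno
    refine hn₀.not_ge ?_
    calc (n₀ : ℝ≥0∞) * ENNReal.ofReal h ≤ k * ENNReal.ofReal h := by gcongr
      _ = ∑ _j : Fin k, ENNReal.ofReal h := by simp
      _ ≤ ∑ j : Fin k, length (exteriorBoundary M (Ω j)) :=
          Finset.sum_le_sum fun j _ => (hno j).le
      _ = length (⋃ j, exteriorBoundary M (Ω j)) := by
          refine ((measure_iUnion₀ (μ := Measure.hausdorffMeasure 1) (fun i j hij => ?_)
            fun j => ?_).trans (tsum_fintype _)).symm
          · exact hM.length_inter_exteriorBoundary (hΩ.1 i) (hΩ.1 j) (hΩ.2 hij)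
          · exact (isClosed_frontier.inter isClosed_frontier).measurableSet.nullMeasurableSet
      _ ≤ length (frontier M) := length_mono (iUnion_subset fun j => inter_subset_right)
  exact (hratio _ (hΩ.1 j) hj).trans (le_iSup (fun j => isoperimetricRatio M (Ω j)) j)

/-! ### Trapezoids at a convex vertex -/

lemma isSmoothArc_line {p w : Plane} (hw : w ≠ 0) : IsSmoothArc fun t : ℝ => p + t • w where
  contDiffOn := by fun_prop
  injOn := fun s _ t _ h => smul_left_injective ℝ hw (add_left_cancel h)
  regular := by
    intro t ht
    have h1 : HasDerivAt (fun t : ℝ => p + t • w) ((1 : ℝ) • w) t :=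
      ((hasDerivAt_id t).smul_const w).const_add p
    rw [h1.hasDerivWithinAt.derivWithin (uniqueDiffOn_Icc zero_lt_one t ht), one_smul]
    exact hw

/-- The open isosceles trapezoid at `p` between the rays in the directions `e` and `e'`. -/
def trapezoid (p e e' : Plane) (a b : ℝ) : Set Plane :=
  {q | ∃ x y : ℝ, 0 < x ∧ 0 < y ∧ a < x + y ∧ x + y < b ∧ q = p + x • e + y • e'}

/-- The closed isosceles trapezoid. -/
def closedTrapezoid (p e e' : Plane) (a b : ℝ) : Set Plane :=
  {q | ∃ x y : ℝ, 0 ≤ x ∧ 0 ≤ y ∧ a ≤ x + y ∧ x + y ≤ b ∧ q = p + x • e + y • e'}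

section Trapezoid

variable {p e e' : Plane} {a b : ℝ}

lemma coord_eq (hk : cross e e' ≠ 0) {q : Plane} {x y : ℝ} :
    q = p + x • e + y • e' ↔
      cross (q - p) e' / cross e e' = x ∧ cross e (q - p) / cross e e' = y := by
  constructor
  · rintro rfl
    rw [add_assoc, add_sub_cancel_left, div_eq_iff hk, div_eq_iff hk, cross_add_left,
      cross_add_right]
    simp only [cross_smul_left, cross_smul_right, cross_self]
    exact ⟨by ring, by ring⟩
  · rintro ⟨rfl, rfl⟩
    have hdec := cross_smul_eq e e' (q - p)
    rw [add_assoc, div_eq_inv_mul, div_eq_inv_mul, mul_smul, mul_smul, ← smul_add, ← hdec,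
      smul_smul, inv_mul_cancel₀ hk, one_smul]
    abel

lemma coord_inj (hk : cross e e' ≠ 0) {x y x' y' : ℝ}
    (h : p + x • e + y • e' = p + x' • e + y' • e') : x = x' ∧ y = y' := by
  have h1 := (coord_eq hk (q := p + x • e + y • e')).1 rfl
  have h2 := (coord_eq hk).1 h
  exact ⟨h1.1.symm.trans h2.1, h1.2.symm.trans h2.2⟩

lemma continuous_coord_left (p e e' : Plane) :
    Continuous fun q : Plane => cross (q - p) e' / cross e e' :=
  ((continuous_cross_left _).comp (by fun_prop)).div_const _

lemma continuous_coord_right (p e e' : Plane) :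
    Continuous fun q : Plane => cross e (q - p) / cross e e' :=
  ((continuous_cross_right _).comp (by fun_prop)).div_const _

lemma isOpen_trapezoid (hk : cross e e' ≠ 0) : IsOpen (trapezoid p e e' a b) := by
  have h1 := continuous_coord_left p e e'
  have h2 := continuous_coord_right p e e'
  convert (isOpen_lt continuous_const h1).inter ((isOpen_lt continuous_const h2).inter
    ((isOpen_lt (continuous_const (y := a)) (h1.add h2)).inter
      (isOpen_lt (h1.add h2) (continuous_const (y := b))))) using 1
  ext q
  constructor
  · rintro ⟨x, y, hx, hy, ha, hb, hq⟩
    obtain ⟨rfl, rfl⟩ := (coord_eq hk).1 hq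
    exact ⟨hx, hy, ha, hb⟩
  · rintro ⟨hx, hy, ha, hb⟩
    exact ⟨_, _, hx, hy, ha, hb, (coord_eq hk).2 ⟨rfl, rfl⟩⟩

lemma isClosed_closedTrapezoid (hk : cross e e' ≠ 0) : IsClosed (closedTrapezoid p e e' a b) := by
  have h1 := continuous_coord_left p e e'
  have h2 := continuous_coord_right p e e'
  convert (isClosed_le continuous_const h1).inter ((isClosed_le continuous_const h2).inter
    ((isClosed_le (continuous_const (y := a)) (h1.add h2)).inter
      (isClosed_le (h1.add h2) (continuous_const (y := b))))) using 1
  ext q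
  constructor
  · rintro ⟨x, y, hx, hy, ha, hb, hq⟩
    obtain ⟨rfl, rfl⟩ := (coord_eq hk).1 hq
    exact ⟨hx, hy, ha, hb⟩
  · rintro ⟨hx, hy, ha, hb⟩
    exact ⟨_, _, hx, hy, ha, hb, (coord_eq hk).2 ⟨rfl, rfl⟩⟩

lemma closure_trapezoid (hk : cross e e' ≠ 0) (ha : 0 < a) (hab : a < b) :
    closure (trapezoid p e e' a b) = closedTrapezoid p e e' a b := by
  apply Subset.antisymm
  · refine (isClosed_closedTrapezoid hk).closure_subset_iff.2 ?_
    rintro q ⟨x, y, hx, hy, h1, h2, rfl⟩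
    exact ⟨x, y, hx.le, hy.le, h1.le, h2.le, rfl⟩
  · rintro q ⟨x, y, hx, hy, h1, h2, rfl⟩
    -- Move towards the point with both coordinates `(a + b) / 4`, whose coordinate sum is the
    -- midpoint of `a` and `b`.
    refine mem_closure_of_eventually (w := ((a + b) / 4 - x) • e + ((a + b) / 4 - y) • e') ?_
    filter_upwards [Ioo_mem_nhdsGT (zero_lt_one' ℝ)] with t ht
    refine ⟨x + t * ((a + b) / 4 - x), y + t * ((a + b) / 4 - y), ?_, ?_, ?_, ?_, ?_⟩
    · nlinarith [ht.1, ht.2, mul_nonneg (sub_nonneg.2 ht.2.le) hx, mul_pos ht.1 (ha.trans hab),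
        mul_pos ht.1 ha]
    · nlinarith [ht.1, ht.2, mul_nonneg (sub_nonneg.2 ht.2.le) hy, mul_pos ht.1 (ha.trans hab),
        mul_pos ht.1 ha]
    · nlinarith [mul_nonneg (sub_nonneg.2 ht.2.le) (sub_nonneg.2 h1), mul_pos ht.1 (sub_pos.2 hab)]
    · nlinarith [mul_nonneg (sub_nonneg.2 ht.2.le) (sub_nonneg.2 h2), mul_pos ht.1 (sub_pos.2 hab)]
    · module

lemma mem_frontier_trapezoid (hk : cross e e' ≠ 0) (ha : 0 < a) (hab : a < b) {q : Plane} :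
    q ∈ frontier (trapezoid p e e' a b) ↔ ∃ x y : ℝ, 0 ≤ x ∧ 0 ≤ y ∧ a ≤ x + y ∧ x + y ≤ b ∧
      (x = 0 ∨ y = 0 ∨ x + y = a ∨ x + y = b) ∧ q = p + x • e + y • e' := by
  rw [(isOpen_trapezoid hk).frontier_eq, closure_trapezoid hk ha hab]
  constructor
  · rintro ⟨⟨x, y, hx, hy, h1, h2, hq⟩, hn⟩
    refine ⟨x, y, hx, hy, h1, h2, ?_, hq⟩
    by_contra hno
    push Not at hno
    exact hn ⟨x, y, lt_of_le_of_ne hx hno.1.symm, lt_of_le_of_ne hy hno.2.1.symm,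
      lt_of_le_of_ne h1 hno.2.2.1.symm, lt_of_le_of_ne h2 hno.2.2.2, hq⟩
  · rintro ⟨x, y, hx, hy, h1, h2, hor, hq⟩
    refine ⟨⟨x, y, hx, hy, h1, h2, hq⟩, ?_⟩
    rintro ⟨x', y', hx', hy', h1', h2', hq'⟩
    obtain ⟨rfl, rfl⟩ := coord_inj hk (hq.symm.trans hq')
    rcases hor with h | h | h | h <;> linarith

/-- The corners of a trapezoid. -/
def corner (p e e' : Plane) (a b : ℝ) : Fin 4 → Plane :=
  ![p + a • e, p + b • e, p + b • e', p + a • e']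

/-- The sides of a trapezoid, as vectors. -/
def side (e e' : Plane) (a b : ℝ) : Fin 4 → Plane :=
  ![(b - a) • e, b • (e' - e), (a - b) • e', a • (e - e')]

/-- The coordinates of a point on a side of a trapezoid. -/
def sideCoord (a b : ℝ) (i : Fin 4) (t : ℝ) : ℝ × ℝ :=
  ![(a + t * (b - a), 0), (b * (1 - t), b * t), (0, b - t * (b - a)), (a * t, a * (1 - t))] i

lemma corner_add_side (i : Fin 4) (t : ℝ) : corner p e e' a b i + t • side e e' a b i =
    p + (sideCoord a b i t).1 • e + (sideCoord a b i t).2 • e' := by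
  fin_cases i <;> simp [corner, side, sideCoord] <;> module

lemma sideCoord_eq (ha : 0 < a) (hab : a < b) {i j : Fin 4} (hij : i < j) {s t : ℝ}
    (hs : s ∈ Icc (0 : ℝ) 1) (ht : t ∈ Icc (0 : ℝ) 1) (h : sideCoord a b i s = sideCoord a b j t) : (s = 0 ∨ s = 1) ∧ (t = 0 ∨ t = 1) := by
  have hb : 0 < b := ha.trans hab
  have hba : b - a ≠ 0 := (sub_pos.2 hab).ne'
  fin_cases i <;> fin_cases j <;> simp [sideCoord] at hij h ⊢
  · have ht0 : t = 0 := h.2.resolve_left hb.ne'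
    subst ht0
    exact ⟨Or.inr (mul_right_cancel₀ hba (by linarith [h.1])), Or.inl rfl⟩
  · have := mul_nonneg hs.1 (sub_pos.2 hab).le
    linarith [h.1]
  · have ht1 : t = 1 := (sub_eq_zero.1 (h.2.resolve_left ha.ne')).symm
    subst ht1
    exact ⟨Or.inl ((mul_eq_zero.1 (show s * (b - a) = 0 by linarith [h.1])).resolve_right hba),
      Or.inr rfl⟩
  · have hs1 : s = 1 := (sub_eq_zero.1 (h.1.resolve_left hb.ne')).symm
    subst hs1
    exact ⟨Or.inr rfl,
      Or.inl ((mul_eq_zero.1 (show t * (b - a) = 0 by linarith [h.2])).resolve_right hba)⟩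
  · linarith [h.1, h.2]
  · have ht0 : t = 0 := h.1.resolve_left ha.ne'
    subst ht0
    exact ⟨Or.inr (mul_right_cancel₀ hba (by linarith [h.2])), Or.inl rfl⟩

lemma isPiecewiseSmooth_frontier_trapezoid (hk : cross e e' ≠ 0) (ha : 0 < a) (hab : a < b) :
    IsPiecewiseSmooth (frontier (trapezoid p e e' a b)) := by
  have hb : 0 < b := ha.trans hab
  have he : e ≠ 0 := by rintro rfl; simp [cross] at hk
  have he' : e' ≠ 0 := by rintro rfl; simp [cross] at hk
  have hee : e ≠ e' := by rintro rfl; simp at hk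
  refine ⟨4, fun i t => corner p e e' a b i + t • side e e' a b i, fun i => ?_, ?_, ?_⟩
  · apply isSmoothArc_line
    fin_cases i <;>
      simp [side, he, he', sub_eq_zero, hee, hee.symm, ha.ne', hb.ne', hab.ne, hab.ne']
  · have key : ∀ i j, i < j → ∀ s ∈ Icc (0 : ℝ) 1, ∀ t ∈ Icc (0 : ℝ) 1,
        corner p e e' a b i + s • side e e' a b i = corner p e e' a b j + t • side e e' a b j →
        (s = 0 ∨ s = 1) ∧ (t = 0 ∨ t = 1) := by
      intro i j hij s hs t ht h
      rw [corner_add_side, corner_add_side] at h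
      obtain ⟨h1, h2⟩ := coord_inj hk h
      exact sideCoord_eq ha hab hij hs ht (Prod.ext h1 h2)
    rintro i j hij _ ⟨⟨s, hs, rfl⟩, t, ht, hte⟩
    have hst : (s = 0 ∨ s = 1) ∧ (t = 0 ∨ t = 1) := by
      rcases lt_or_gt_of_ne hij with h | h
      · exact key i j h s hs t ht hte.symm
      · exact (key j i h t ht s hs hte).symm
    exact ⟨⟨s, hst.1, rfl⟩, t, hst.2, hte⟩
  · ext q
    rw [mem_frontier_trapezoid hk ha hab, mem_iUnion]
    constructor
    · rintro ⟨x, y, hx, hy, h1, h2, hor, rfl⟩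
      have hba : 0 < b - a := sub_pos.2 hab
      have key : ∀ (i : Fin 4) (t : ℝ), t ∈ Icc (0 : ℝ) 1 → sideCoord a b i t = (x, y) →
          ∃ i, p + x • e + y • e' ∈
            (fun t : ℝ => corner p e e' a b i + t • side e e' a b i) '' Icc 0 1 := by
        intro i t ht h
        refine ⟨i, t, ht, ?_⟩
        simp only
        rw [corner_add_side, h]
      rcases hor with rfl | rfl | h | h
      · refine key 2 ((b - y) / (b - a)) ⟨div_nonneg (by linarith) hba.le,
          (div_le_one hba).2 (by linarith)⟩ ?_
        simp [sideCoord, div_mul_cancel₀ _ hba.ne']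
      · refine key 0 ((x - a) / (b - a)) ⟨div_nonneg (by linarith) hba.le,
          (div_le_one hba).2 (by linarith)⟩ ?_
        simp [sideCoord, div_mul_cancel₀ _ hba.ne']
      · refine key 3 (x / a) ⟨div_nonneg hx ha.le, (div_le_one ha).2 (by linarith)⟩ ?_
        simp only [sideCoord, Matrix.cons_val]
        rw [mul_sub, mul_div_cancel₀ _ ha.ne']
        ext <;> simp; linarith
      · refine key 1 (y / b) ⟨div_nonneg hy hb.le, (div_le_one hb).2 (by linarith)⟩ ?_
        simp only [sideCoord, Matrix.cons_val]
        rw [mul_sub, mul_div_cancel₀ _ hb.ne']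
        ext <;> simp; linarith
    · rintro ⟨i, t, ht, rfl⟩
      simp only
      rw [corner_add_side]
      have h1 := mul_nonneg ht.1 (sub_pos.2 hab).le
      have h2 := mul_nonneg (sub_nonneg.2 ht.2) (sub_pos.2 hab).le
      have h3 := mul_nonneg ha.le ht.1
      have h4 := mul_nonneg ha.le (sub_nonneg.2 ht.2)
      have h5 := mul_nonneg hb.le ht.1
      have h6 := mul_nonneg hb.le (sub_nonneg.2 ht.2)
      refine ⟨_, _, ?_, ?_, ?_, ?_, ?_, rfl⟩
      · fin_cases i <;> simp [sideCoord] <;> nlinarith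
      · fin_cases i <;> simp [sideCoord] <;> nlinarith
      · fin_cases i <;> simp [sideCoord] <;> nlinarith
      · fin_cases i <;> simp [sideCoord] <;> nlinarith
      · fin_cases i
        · exact Or.inr (Or.inl rfl)
        · refine Or.inr (Or.inr (Or.inr ?_))
          change b * (1 - t) + b * t = b
          ring
        · exact Or.inl rfl
        · refine Or.inr (Or.inr (Or.inl ?_))
          change a * t + a * (1 - t) = a
          ring

end Trapezoid

/-! ### The upper bound -/

/-- Two unit vectors enclosing the angle `φ` have distance `2 sin (φ / 2)`. -/
lemma norm_sub_unit {a b : Plane} (ha : ‖a‖ = 1) (hb : ‖b‖ = 1) :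
    ‖a - b‖ = 2 * Real.sin (Real.arccos (dot a b) / 2) := by
  have hs0 : 0 ≤ Real.sin (Real.arccos (dot a b) / 2) :=
    Real.sin_nonneg_of_nonneg_of_le_pi (by linarith [Real.arccos_nonneg (dot a b)])
      (by linarith [Real.pi_pos, Real.arccos_le_pi (dot a b)])
  rw [← sq_eq_sq₀ (norm_nonneg _) (by positivity), mul_pow, sq_sin_half_arccos ha hb,
    norm_sq_eq_dot]
  have h1 := dot_self_eq_one ha
  have h2 := dot_self_eq_one hb
  simp only [dot, PiLp.sub_apply] at h1 h2 ⊢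
  linear_combination h1 + h2

lemma length_segment_add_smul {p e : Plane} (he : ‖e‖ = 1) {a b : ℝ} (hab : a ≤ b) :
    length (segment ℝ (p + a • e) (p + b • e)) = ENNReal.ofReal (b - a) := by
  rw [length_segment, edist_dist, dist_add_left, dist_eq_norm, ← sub_smul, norm_smul, he, mul_one,
    Real.norm_eq_abs, abs_sub_comm, abs_of_nonneg (sub_nonneg.2 hab)]

lemma measurableSet_segment (x y : Plane) : MeasurableSet (segment ℝ x y) := by
  rw [← convexHull_pair (𝕜 := ℝ)]
  exact ((toFinite {x, y}).isCompact_convexHull ℝ).isClosed.measurableSet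

/-- Small trapezoids at a convex vertex are admissible, and their isoperimetric ratio is explicit. -/
lemma IsPolygon.trapezoid_spec (hM : IsPolygon n v M) {f : ZMod n × Bool}
    (hf : IsConvexAt M v f) : ∃ ρ : ℝ, 0 < ρ ∧ ∀ a b, 0 < a → a < b → b ≤ ρ →
      trapezoid (tail v f) (dir v f) (dir v (mate f)) a b ∈ admissible M ∧
      isoperimetricRatio M (trapezoid (tail v f) (dir v f) (dir v (mate f)) a b) ≤
        ENNReal.ofReal ((b + a) / (b - a) *
          Real.sin (Real.arccos (dot (dir v f) (dir v (mate f))) / 2)) := by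
  obtain ⟨hk, r, hr, hsec⟩ := hf
  have he := hM.isSimple.norm_dir f
  have he' := hM.isSimple.norm_dir (mate f)
  have hl := hM.isSimple.len_pos f
  have hl' := hM.isSimple.len_pos (mate f)
  have hnorm := norm_sub_unit he he'
  set p := tail v f with hp
  set e := dir v f
  set e' := dir v (mate f)
  set σ := Real.sin (Real.arccos (dot e e') / 2)
  have hσ : 0 ≤ σ := by have := norm_nonneg (e - e'); linarith
  have hk2 : 0 < cross e e' * cross e e' := mul_self_pos.2 hk
  -- The bound `r` keeps the trapezoid in the sector, since points have distance at most `x + y < b`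
  -- from `p`; the edge lengths keep its legs on the two edges.
  refine ⟨min r (min (len v f) (len v (mate f))), lt_min hr (lt_min hl hl'), ?_⟩
  intro a b ha hab hbρ
  rw [le_min_iff, le_min_iff] at hbρ
  have hba := sub_pos.2 hab
  have hsub : trapezoid p e e' a b ⊆ M := by
    rintro _ ⟨x, y, hx, hy, h1, h2, rfl⟩
    refine hsec ⟨?_, ?_, ?_⟩
    · rw [Metric.mem_ball, dist_eq_norm, add_assoc, add_sub_cancel_left]
      calc ‖x • e + y • e'‖ ≤ ‖x • e‖ + ‖y • e'‖ := norm_add_le _ _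
        _ = x + y := by
          rw [norm_smul, norm_smul, he, he', Real.norm_of_nonneg hx.le, Real.norm_of_nonneg hy.le,
            mul_one, mul_one]
        _ < r := by linarith
    · rw [mem_ofPred_eq, add_assoc, add_sub_cancel_left, cross_add_left, cross_smul_left,
        cross_smul_left, cross_self]
      have := mul_pos hx hk2
      linarith
    · rw [mem_ofPred_eq, add_assoc, add_sub_cancel_left, cross_add_left, cross_smul_left,
        cross_smul_left, cross_self, cross_swap e' e]
      have := mul_pos hy hk2
      linarith
  refine ⟨⟨hsub, ?_, isOpen_trapezoid hk, isPiecewiseSmooth_frontier_trapezoid hk ha hab⟩, ?_⟩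
  · exact ⟨_, (a + b) / 4, (a + b) / 4, by linarith, by linarith, by linarith, by linarith, rfl⟩
  have hedge : ∀ x, 0 ≤ x → x ≤ b → p + x • e ∈ frontier M := fun x h1 h2 =>
    hM.mem_frontier_iff.2 ⟨_, (hM.isSimple.mem_edge_iff f).2 ⟨x, ⟨h1, h2.trans hbρ.2.1⟩, rfl⟩⟩
  have hedge' : ∀ x, 0 ≤ x → x ≤ b → p + x • e' ∈ frontier M := fun x h1 h2 =>
    hM.mem_frontier_iff.2 ⟨_, (hM.isSimple.mem_edge_iff (mate f)).2
      ⟨x, ⟨h1, h2.trans hbρ.2.2⟩, by rw [tail_mate]⟩⟩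
  set S := segment ℝ (p + a • e) (p + b • e) with hS
  set S' := segment ℝ (p + a • e') (p + b • e') with hS'
  have hmemS : ∀ q ∈ S, ∃ t ∈ Icc a b, q = p + t • e := by
    rintro q ⟨c, d, hc, hd, hcd, rfl⟩
    obtain rfl : c = 1 - d := by linarith
    refine ⟨(1 - d) * a + d * b, ⟨by nlinarith, by nlinarith⟩, by module⟩
  have hmemS' : ∀ q ∈ S', ∃ t ∈ Icc a b, q = p + t • e' := by
    rintro q ⟨c, d, hc, hd, hcd, rfl⟩
    obtain rfl : c = 1 - d := by linarith
    refine ⟨(1 - d) * a + d * b, ⟨by nlinarith, by nlinarith⟩, by module⟩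
  have hext : S ∪ S' ⊆ exteriorBoundary M (trapezoid p e e' a b) := by
    rintro q (hq | hq)
    · obtain ⟨t, ht, rfl⟩ := hmemS q hq
      refine ⟨(mem_frontier_trapezoid hk ha hab).2 ⟨t, 0, by linarith [ht.1], le_rfl,
        by linarith [ht.1], by linarith [ht.2], Or.inr (Or.inl rfl), by simp⟩,
        hedge t (by linarith [ht.1]) ht.2⟩
    · obtain ⟨t, ht, rfl⟩ := hmemS' q hq
      refine ⟨(mem_frontier_trapezoid hk ha hab).2 ⟨0, t, le_rfl, by linarith [ht.1],
        by linarith [ht.1], by linarith [ht.2], Or.inl rfl, by simp⟩,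
        hedge' t (by linarith [ht.1]) ht.2⟩
  have hdisj : Disjoint S S' := by
    rw [Set.disjoint_left]
    intro q hq hq'
    obtain ⟨t, ht, rfl⟩ := hmemS q hq
    obtain ⟨t', ht', h⟩ := hmemS' _ hq'
    have := coord_inj (p := p) hk (x := t) (y := 0) (x' := 0) (y' := t') (by simpa using h)
    linarith [ht.1, this.1]
  have hextlen : ENNReal.ofReal (2 * (b - a)) ≤
      length (exteriorBoundary M (trapezoid p e e' a b)) := by
    refine le_trans ?_ (length_mono hext)
    have h1 : length (S ∪ S') = length S + length S' :=
      measure_union hdisj (measurableSet_segment _ _)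
    rw [h1, hS, hS', length_segment_add_smul he hab.le, length_segment_add_smul he' hab.le,
      ← ENNReal.ofReal_add hba.le hba.le, two_mul]
  have hint : interiorBoundary M (trapezoid p e e' a b) ⊆
      segment ℝ (p + a • e) (p + a • e') ∪ segment ℝ (p + b • e) (p + b • e') := by
    rintro q ⟨hq, hqM⟩
    have hnot := Set.disjoint_left.1 hM.disjoint_frontier hqM
    obtain ⟨x, y, hx, hy, h1, h2, hor, rfl⟩ := (mem_frontier_trapezoid hk ha hab).1 hq
    have key : ∀ c, 0 < c → x + y = c →
        p + x • e + y • e' ∈ segment ℝ (p + c • e) (p + c • e') := by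
      rintro c hc rfl
      refine ⟨x / (x + y), y / (x + y), div_nonneg hx hc.le, div_nonneg hy hc.le, ?_, ?_⟩
      · rw [← add_div, div_self hc.ne']
      · have e1 : x / (x + y) + y / (x + y) = 1 := by rw [← add_div, div_self hc.ne']
        rw [smul_add, smul_add, smul_smul, smul_smul, div_mul_cancel₀ _ hc.ne',
          div_mul_cancel₀ _ hc.ne', add_add_add_comm, ← add_smul, e1, one_smul, add_assoc]
    rcases hor with rfl | rfl | h | h
    · exact absurd (hedge' y hy (by linarith)) (by simpa using hnot)
    · exact absurd (hedge x hx (by linarith)) (by simpa using hnot)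
    · exact Or.inl (key a ha h)
    · exact Or.inr (key b (ha.trans hab) h)
  have hseg : ∀ c, 0 < c →
      length (segment ℝ (p + c • e) (p + c • e')) = ENNReal.ofReal (c * (2 * σ)) := by
    intro c hc
    rw [length_segment, edist_dist, dist_add_left, dist_eq_norm, ← smul_sub, norm_smul,
      Real.norm_of_nonneg hc.le, hnorm]
  have hintlen : length (interiorBoundary M (trapezoid p e e' a b)) ≤
      ENNReal.ofReal ((b + a) * (2 * σ)) := by
    refine (length_mono hint).trans ((measure_union_le _ _).trans ?_)
    refine (add_le_add (hseg a ha).le (hseg b (ha.trans hab)).le).trans ?_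
    rw [← ENNReal.ofReal_add (by positivity) (mul_nonneg (ha.trans hab).le (by positivity))]
    exact ENNReal.ofReal_le_ofReal (by linarith)
  rw [isoperimetricRatio, if_neg]
  · refine ENNReal.div_le_of_le_mul (hintlen.trans ?_)
    refine le_trans ?_ (mul_le_mul_right hextlen _)
    rw [← ENNReal.ofReal_mul (mul_nonneg (div_nonneg (by linarith) hba.le) hσ)]
    refine ENNReal.ofReal_le_ofReal (le_of_eq ?_)
    field_simp
  · refine (nonempty_iff_ne_empty.1 ⟨_, hext (Or.inl (left_mem_segment ℝ _ _))⟩)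

lemma disjoint_trapezoid {p e e' : Plane} (hk : cross e e' ≠ 0) {a b a' b' : ℝ} (h : b' ≤ a) :
    Disjoint (trapezoid p e e' a b) (trapezoid p e e' a' b') := by
  rw [Set.disjoint_left]
  rintro q ⟨x, y, -, -, h1, -, rfl⟩ ⟨x', y', -, -, -, h2, hq⟩
  obtain ⟨rfl, rfl⟩ := coord_inj hk hq
  linarith

/-- The upper bound for the Escobar constants. -/
theorem IsPolygon.escobarConstant_le (hM : IsPolygon n v M) (k : ℕ) :
    escobarConstant M k ≤ ENNReal.ofReal (Real.sin ((⨅ i, interiorAngle M v i) / 2)) := by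
  have hfin := hM.isSimple.finite
  obtain ⟨i, hi⟩ := exists_eq_ciInf_of_finite (f := fun i => interiorAngle M v i)
  have hlt : interiorAngle M v i < π := by
    obtain ⟨j, hj⟩ := hM.exists_interiorAngle_lt
    rw [hi]; exact (hM.iInf_interiorAngle_le j).trans_lt hj
  have hconv := hM.isConvexAt_of_interiorAngle_lt hlt
  have hangle := hM.interiorAngle_of_isConvexAt hconv
  rw [show idx (i, true) = i from rfl] at hangle
  rw [← hi, hangle]
  obtain ⟨ρ, hρ, hspec⟩ := hM.trapezoid_spec hconv
  set σ := Real.sin (Real.arccos (dot (dir v (i, true)) (dir v (mate (i, true)))) / 2)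
  -- With radii in geometric progression every trapezoid has `a / b = l`, so all have the same bound
  -- for their ratio, and consecutive ones share only the radius `ρ * l ^ (j + 1)`.
  have hbound : ∀ l ∈ Ioo (0 : ℝ) 1,
      escobarConstant M k ≤ ENNReal.ofReal ((1 + l) / (1 - l) * σ) := by
    intro l hl
    set Ω : Fin k → Set Plane := fun j => trapezoid (tail v (i, true)) (dir v (i, true))
      (dir v (mate (i, true))) (ρ * l ^ (j + 1 : ℕ)) (ρ * l ^ (j : ℕ)) with hΩ
    have hj : ∀ j : Fin k, 0 < ρ * l ^ (j + 1 : ℕ) ∧ ρ * l ^ (j + 1 : ℕ) < ρ * l ^ (j : ℕ) ∧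
        ρ * l ^ (j : ℕ) ≤ ρ := by
      intro j
      have h1 := pow_pos hl.1 (j : ℕ)
      refine ⟨mul_pos hρ (pow_pos hl.1 _), ?_, ?_⟩
      · rw [pow_succ]
        have := mul_pos hρ h1
        nlinarith [hl.2]
      · exact mul_le_of_le_one_right hρ.le (pow_le_one₀ hl.1.le hl.2.le)
    have hord : ∀ j j' : Fin k, j < j' → Disjoint (Ω j) (Ω j') := by
      intro j j' hjj
      refine disjoint_trapezoid hconv.1 ?_
      exact mul_le_mul_of_nonneg_left (pow_le_pow_of_le_one hl.1.le hl.2.le hjj) hρ.le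
    have hmem : Ω ∈ admissibleTuples M k := by
      refine ⟨fun j => (hspec _ _ (hj j).1 (hj j).2.1 (hj j).2.2).1, fun j j' hjj => ?_⟩
      rcases lt_or_gt_of_ne hjj with h | h
      · exact hord j j' h
      · exact (hord j' j h).symm
    refine (iInf₂_le Ω hmem).trans (iSup_le fun j => ?_)
    refine (hspec _ _ (hj j).1 (hj j).2.1 (hj j).2.2).2.trans (le_of_eq ?_)
    congr 2
    have h1 := pow_pos hl.1 (j : ℕ)
    have h2 : 1 - l ≠ 0 := (sub_pos.2 hl.2).ne'
    have h3 : ρ * l ^ (j : ℕ) ≠ 0 := (mul_pos hρ h1).ne'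
    rw [pow_succ, show ρ * l ^ (j : ℕ) + ρ * (l ^ (j : ℕ) * l) = ρ * l ^ (j : ℕ) * (1 + l) by ring,
      show ρ * l ^ (j : ℕ) - ρ * (l ^ (j : ℕ) * l) = ρ * l ^ (j : ℕ) * (1 - l) by ring,
      mul_div_mul_left _ _ h3]
  have hlim : Tendsto (fun l : ℝ => ENNReal.ofReal ((1 + l) / (1 - l) * σ)) (𝓝[>] 0)
      (𝓝 (ENNReal.ofReal σ)) := by
    have hc : ContinuousAt (fun l : ℝ => (1 + l) / (1 - l) * σ) 0 := by
      refine ContinuousAt.mul (ContinuousAt.div (by fun_prop) (by fun_prop) (by norm_num))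
        continuousAt_const
    have h1 := hc.tendsto
    simp only [add_zero, sub_zero, div_one, one_mul] at h1
    exact (ENNReal.continuous_ofReal.tendsto _).comp (h1.mono_left nhdsWithin_le_nhds)
  refine ge_of_tendsto hlim ?_
  filter_upwards [Ioo_mem_nhdsGT (zero_lt_one' ℝ)] with l hl
  exact hbound l hl

end Escobar

end

theorem mainTheorem6 (n : ℕ) (v : ZMod n → Escobar.Plane) (M : Set Escobar.Plane)
    (hM : Escobar.IsPolygon n v M) :
    ∃ n₀ : ℕ, n ≤ n₀ ∧ ∀ k : ℕ, n₀ ≤ k →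
      Escobar.escobarConstant M k =
        ENNReal.ofReal (Real.sin ((⨅ i : ZMod n, Escobar.interiorAngle M v i) / 2)) := by
  obtain ⟨n₀, hn₀⟩ := hM.exists_le_escobarConstant
  exact ⟨max n n₀, le_max_left _ _, fun k hk =>
    le_antisymm (hM.escobarConstant_le k) (hn₀ k ((le_max_right _ _).trans hk))⟩
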